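/- For pairwise coprime integers $p,q,r\ge 3$ let $$Q_{\{p,q,r\}}(x)=\frac{(x^{pqr}-1)(x^p-1)(x^q-1)(x^r-1)}{(x^{pq}-1)(x^{qr}-1)(x^{rp}-1)(x-1)}=\sum_{0\le m\le (p-1)(q-1)(r-1)}a_m x^m$$ be the ternary inclusion–exclusion polynomial, which is a polynomial with integer coefficients of degree $(p-1)(q-1)(r-1)$. Put $\mathcal A_{p,q,r}=\{a_m\}$ (the set of its coefficients), $A^+(p,q,r)=\max_m a_m$, $A^-(p,q,r)=\min_m a_m$ and $A(p,q,r)=\max_m|a_m|$. Let $p\ge 3$ be an integer, let $t\in[1,p-1]$ be an integer coprime to $p$, let $s\in[1,p-1]$ be the inverse of $t$ modulo $p$, and put $\underline t=\min(t,p-t)$ and $\underline s=\min(s,p-s)$. Let $q,r,r'$ be integers with $r,r'>q>p^2$, $q\equiv t\pmod p$, $rt\equiv 1\pmod{pq}$ and $r't\equiv -1\pmod{pq}$. Then $$\mathcal A_{p,q,r'}=-\mathcal A_{p,q,r}:=\{-a: a\in\mathcal A_{p,q,r}\}.$$ Moreover: (i) If $t=s=1$, then $A^-(p,q,r)=-1$,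 $A^+(p,q,r)=1$ and $A(p,q,r)=1$. (ii) If $t>1$ and $\underline s<\underline t$, then $A^-(p,q,r)=-\underline s-1$, $A^+(p,q,r)=\underline s+1$ and $A(p,q,r)=\underline s+1$. (iii) If $t>1$, $\underline s\ge\underline t$ and $(\underline t,\underline s)=(t,s)$ or $(p-t,p-s)$, then $A^-(p,q,r)=-\underline s$, $A^+(p,q,r)=\underline s+1$ and $A(p,q,r)=\underline s+1$. (iv) If $t>1$, $\underline s\ge\underline t$ and $(\underline t,\underline s)=(t,p-s)$ or $(p-t,s)$, then $A^-(p,q,r)=-\underline s-1$, $A^+(p,q,r)=\underline s$ and $A(p,q,r)=\underline s+1$. -/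

import Mathlib

open Polynomial

namespace InclusionExclusion

/-- The numerator `(x^{pqr} - 1)(x^p - 1)(x^q - 1)(x^r - 1)`. -/
noncomputable def num (p q r : ℕ) : ℤ[X] :=
  (X ^ (p * q * r) - 1) * (X ^ p - 1) * (X ^ q - 1) * (X ^ r - 1)

/-- The denominator `(x^{pq} - 1)(x^{qr} - 1)(x^{rp} - 1)(x - 1)`. -/
noncomputable def den (p q r : ℕ) : ℤ[X] :=
  (X ^ (p * q) - 1) * (X ^ (q * r) - 1) * (X ^ (r * p) - 1) * (X - 1)

/-- The ternary inclusion-exclusion polynomial `Q_{p,q,r}`: the quotient of `num` by the monic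
polynomial `den`. The division is exact when `p, q, r` are positive and pairwise coprime,
see `Q_mul_den`. -/
noncomputable def Q (p q r : ℕ) : ℤ[X] := num p q r /ₘ den p q r

/-- `φ(p,q,r) = (p-1)(q-1)(r-1)`, the degree of `Q p q r`, see `natDegree_Q`. -/
def phi (p q r : ℕ) : ℕ := (p - 1) * (q - 1) * (r - 1)

/-- The coefficient set `𝒜_{p,q,r} = {a_m : 0 ≤ m ≤ φ(p,q,r)}`. -/
noncomputable def coeffSet (p q r : ℕ) : Finset ℤ :=
  (Finset.range (phi p q r + 1)).image (fun m => (Q p q r).coeff m)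

theorem coeffSet_nonempty (p q r : ℕ) : (coeffSet p q r).Nonempty :=
  Finset.Nonempty.image (Finset.nonempty_range_iff.mpr (Nat.succ_ne_zero _)) _

/-- `A⁺(p,q,r)`, the largest coefficient. -/
noncomputable def Aplus (p q r : ℕ) : ℤ := (coeffSet p q r).max' (coeffSet_nonempty p q r)

/-- `A⁻(p,q,r)`, the smallest coefficient. -/
noncomputable def Aminus (p q r : ℕ) : ℤ := (coeffSet p q r).min' (coeffSet_nonempty p q r)

/-- The height `A(p,q,r)`, the largest absolute value of a coefficient. -/
noncomputable def height (p q r : ℕ) : ℤ :=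
  (coeffSet p q r).sup' (coeffSet_nonempty p q r) (fun a => |a|)

theorem den_monic {p q r : ℕ} (hp : 0 < p) (hq : 0 < q) (hr : 0 < r) : (den p q r).Monic := by
  have h : ∀ n : ℕ, 0 < n → (X ^ n - 1 : ℤ[X]).Monic := fun n hn => by
    simpa using monic_X_pow_sub_C (1 : ℤ) hn.ne'
  have h1 : (X - 1 : ℤ[X]).Monic := by simpa using h 1 one_pos
  exact (((h _ (by positivity)).mul (h _ (by positivity))).mul (h _ (by positivity))).mul h1

theorem den_dvd_num {p q r : ℕ} (hp : 0 < p) (hq : 0 < q) (hr : 0 < r)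
    (hpq : p.Coprime q) (hqr : q.Coprime r) (hrp : r.Coprime p) : den p q r ∣ num p q r := by
  have hN : p * q * r ≠ 0 := by positivity
  have key : ∀ n : ℕ, n ∣ p * q * r → (X ^ n - 1 : ℤ[X]) =
      ∏ d ∈ (p * q * r).divisors, cyclotomic d ℤ ^ (if d ∣ n then 1 else 0) := by
    intro n hn
    have hn0 : 0 < n := Nat.pos_of_dvd_of_pos hn (Nat.pos_of_ne_zero hN)
    rw [← prod_cyclotomic_eq_X_pow_sub_one hn0 ℤ]
    have : n.divisors = (p * q * r).divisors.filter (fun d => d ∣ n) := by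
      ext d
      simp only [Nat.mem_divisors, Finset.mem_filter]
      exact ⟨fun h => ⟨⟨h.1.trans hn, hN⟩, h.1⟩, fun h => ⟨h.2, hn0.ne'⟩⟩
    rw [this, Finset.prod_filter]
    refine Finset.prod_congr rfl fun d _ => ?_
    split_ifs <;> simp
  have k1 := key 1 (one_dvd _)
  rw [pow_one] at k1
  unfold den num
  rw [k1, key (p * q * r) dvd_rfl, key p ⟨q * r, by ring⟩, key q ⟨p * r, by ring⟩,
    key r ⟨p * q, by ring⟩, key (p * q) ⟨r, by ring⟩, key (q * r) ⟨p, by ring⟩,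
    key (r * p) ⟨q, by ring⟩]
  simp only [← Finset.prod_mul_distrib, ← pow_add]
  refine Finset.prod_dvd_prod_of_dvd _ _ fun d hd => pow_dvd_pow _ ?_
  have h0 : d ∣ p * q * r := (Nat.mem_divisors.1 hd).1
  have common : ∀ a b c : ℕ, a.Coprime c → d ∣ a * b → d ∣ b * c → d ∣ b := by
    intro a b c hac h1 h2
    have := Nat.dvd_gcd h1 (by rwa [mul_comm] at h2 : d ∣ c * b)
    rwa [Nat.gcd_mul_right, hac.gcd_eq_one, one_mul] at this
  have c1 := common p q r hrp.symm
  have c2 := common q r p hpq.symm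
  have c3 := common r p q hqr.symm
  have o1 : d ∣ p → d ∣ q → d ∣ 1 := fun h1 h2 => hpq.gcd_eq_one ▸ Nat.dvd_gcd h1 h2
  have o2 : d ∣ q → d ∣ r → d ∣ 1 := fun h1 h2 => hqr.gcd_eq_one ▸ Nat.dvd_gcd h1 h2
  have o3 : d ∣ r → d ∣ p → d ∣ 1 := fun h1 h2 => hrp.gcd_eq_one ▸ Nat.dvd_gcd h1 h2
  have e1 : d ∣ 1 → d ∣ p ∧ d ∣ q ∧ d ∣ r := fun h =>
    ⟨h.trans (one_dvd _), h.trans (one_dvd _), h.trans (one_dvd _)⟩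
  have i1 : d ∣ p → d ∣ p * q ∧ d ∣ r * p := fun h => ⟨h.mul_right _, h.mul_left _⟩
  have i2 : d ∣ q → d ∣ p * q ∧ d ∣ q * r := fun h => ⟨h.mul_left _, h.mul_right _⟩
  have i3 : d ∣ r → d ∣ q * r ∧ d ∣ r * p := fun h => ⟨h.mul_left _, h.mul_right _⟩
  by_cases a1 : d ∣ p * q <;> by_cases a2 : d ∣ q * r <;> by_cases a3 : d ∣ r * p <;>
    by_cases b1 : d ∣ p <;> by_cases b2 : d ∣ q <;> by_cases b3 : d ∣ r <;>
    by_cases b0 : d ∣ 1 <;> simp only [h0, a1, a2, a3, b1, b2, b3, b0, if_true, if_false] <;>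
    omega

/-- `Q p q r` is the polynomial quotient of `num` by `den`. -/
theorem Q_mul_den {p q r : ℕ} (hp : 0 < p) (hq : 0 < q) (hr : 0 < r)
    (hpq : p.Coprime q) (hqr : q.Coprime r) (hrp : r.Coprime p) :
    Q p q r * den p q r = num p q r := by
  have h := modByMonic_add_div (num p q r) (den p q r)
  rw [(modByMonic_eq_zero_iff_dvd (den_monic hp hq hr)).2
    (den_dvd_num hp hq hr hpq hqr hrp), zero_add] at h
  rw [mul_comm]
  exact h

theorem natDegree_Q {p q r : ℕ} (hp : 0 < p) (hq : 0 < q) (hr : 0 < r) :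
    (Q p q r).natDegree = phi p q r := by
  have hm : ∀ n : ℕ, 0 < n → (X ^ n - 1 : ℤ[X]).Monic := fun n hn => by
    simpa using monic_X_pow_sub_C (1 : ℤ) hn.ne'
  have hd : ∀ n : ℕ, (X ^ n - 1 : ℤ[X]).natDegree = n := fun n => by
    simpa using natDegree_X_pow_sub_C (n := n) (r := (1 : ℤ))
  have m1 := hm 1 one_pos
  have d1 := hd 1
  rw [pow_one] at m1 d1
  have a := hm (p * q) (by positivity)
  have b := hm (q * r) (by positivity)
  have c := hm (r * p) (by positivity)
  have e := hm (p * q * r) (by positivity)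
  unfold Q
  rw [natDegree_divByMonic _ (den_monic hp hq hr)]
  unfold num den phi
  rw [((e.mul (hm p hp)).mul (hm q hq)).natDegree_mul (hm r hr),
    (e.mul (hm p hp)).natDegree_mul (hm q hq), e.natDegree_mul (hm p hp),
    ((a.mul b).mul c).natDegree_mul m1, (a.mul b).natDegree_mul c, a.natDegree_mul b, d1]
  simp only [hd]
  obtain ⟨x, rfl⟩ : ∃ x, p = x + 1 := ⟨p - 1, by omega⟩
  obtain ⟨y, rfl⟩ : ∃ y, q = y + 1 := ⟨q - 1, by omega⟩
  obtain ⟨z, rfl⟩ : ∃ z, r = z + 1 := ⟨r - 1, by omega⟩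
  simp only [Nat.add_sub_cancel]
  apply Nat.sub_eq_of_eq_add
  ring

end InclusionExclusion

/-!
Up to the factor `1 - x ^ (p q)`, the polynomial `Q p q r` is the binary inclusion-exclusion
polynomial evaluated at `x ^ r`, times `(1 + ⋯ + x ^ (p - 1)) (1 - x ^ q)`. Hence its coefficient at
`n` is a sum of binary coefficients over indices fixed by `n` modulo `p q`, cut off at `⌊n / r⌋`.
Every cut-off value is attained in every residue class, so the coefficient set depends on `r` only
modulo `p q`, and reflecting `n` shows that it changes sign with `r`.

If `r t ≡ 1` modulo `p q`, these sums run along the progressions `w - t j` and `w - t q - t j`,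
`0 ≤ j < p`. As `t p < q`, each progression meets at most two of the blocks `[q e, q (e + 1))`, and
as the two starting points are at least a block apart modulo `p q`, one of the progressions is kept
or dropped as a whole. Their full sums agree, so every coefficient is, up to sign, the sum of the
binary coefficients over a window of one progression.

A binary coefficient is a difference of two indicators of an arc of length `s` in `ℤ / p`, and
along a progression both arguments run through `ℤ / p` at unit speed, except that the second one
pauses once, where the progression changes blocks. So with `k = min s (p - s)` a window sums, up to
the sign that passes from the arc to its complement, to at most `k` and at least `-k - 1`. The value
`-k - 1` needs the pause and forces the block `e` of the starting point to satisfy `k ≤ e < p - k`.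
Windows that count with a plus sign have `e < t` or `e ≥ p - t`, those with a minus sign `e < p - t`
or `e ≥ t`. So `-k - 1` occurs with a plus sign only if `k < t` and with a minus sign only if
`k < p - t`.
-/

namespace InclusionExclusion

section Divisibility

theorem dvd_iff_eq_zero_of_lt {M a : ℤ} (h1 : -M < a) (h2 : a < M) : M ∣ a ↔ a = 0 :=
  ⟨fun h => Int.eq_zero_of_abs_lt_dvd h (abs_lt.2 ⟨h1, h2⟩), fun h => h ▸ dvd_zero M⟩

theorem exists_dvd_sub_of_pos {M : ℤ} (hM : 0 < M) (x : ℤ) : ∃ d, 0 ≤ d ∧ d < M ∧ M ∣ x - d :=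
  ⟨x % M, Int.emod_nonneg x hM.ne', Int.emod_lt_of_pos x hM, Int.dvd_self_sub_emod⟩

theorem dvd_mul_iff_of_dvd_mul_sub_one {a b m x : ℤ} (h : m ∣ a * b - 1) : m ∣ a * x ↔ m ∣ x := by
  obtain ⟨c, hc⟩ := h
  have coprime : IsCoprime m a := ⟨-c, b, by linear_combination hc⟩
  exact ⟨coprime.dvd_of_dvd_mul_left, fun hx => hx.mul_left a⟩

theorem coprime_of_dvd_mul_sub_one {m n : ℕ} {a : ℤ} (h : (m : ℤ) ∣ a * n - 1) :
    m.Coprime n := by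
  obtain ⟨c, hc⟩ := h
  exact Nat.isCoprime_iff_coprime.1 ⟨-c, a, by linear_combination hc⟩

theorem eq_of_periodic_of_dvd_sub {α : Type*} {f : ℤ → α} {m x y : ℤ} (hf : f.Periodic m)
    (h : m ∣ x - y) : f x = f y := by
  obtain ⟨c, hc⟩ := h
  rw [← hf.int_mul c y]
  congr 1
  linear_combination hc

end Divisibility

section PeriodicSeries

theorem mk_mul_one_sub_X_pow_of_periodic {R : Type*} [Ring R] {f : ℕ → R} {m : ℕ}
    (hf : f.Periodic m) :
    PowerSeries.mk f * (1 - PowerSeries.X ^ m) =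
      ∑ i ∈ Finset.range m, PowerSeries.C (f i) * PowerSeries.X ^ i := by
  ext n
  rw [mul_sub, mul_one, map_sub, PowerSeries.coeff_mul_X_pow', map_sum]
  simp only [PowerSeries.coeff_mk, PowerSeries.coeff_C_mul, PowerSeries.coeff_X_pow, mul_ite,
    mul_one, mul_zero, Finset.sum_ite_eq, Finset.mem_range]
  rcases lt_or_ge n m with h | h
  · rw [if_neg h.not_ge, if_pos h, sub_zero]
  · rw [if_pos h, if_neg h.not_gt, ← hf (n - m), Nat.sub_add_cancel h, sub_self]

theorem mk_dvd_sub_mul_one_sub_X_pow {m M : ℕ} (hm : m < M) :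
    (PowerSeries.mk fun n : ℕ => if (M : ℤ) ∣ n - m then (1 : ℤ) else 0) *
      (1 - PowerSeries.X ^ M) = PowerSeries.X ^ m := by
  rw [mk_mul_one_sub_X_pow_of_periodic fun n => ?_]
  · rw [Finset.sum_eq_single_of_mem m (Finset.mem_range.2 hm) fun n hn hne => ?_]
    · rw [sub_self, if_pos (dvd_zero _), map_one, one_mul]
    · rw [Finset.mem_range] at hn
      have : ¬ (M : ℤ) ∣ n - m := by
        rw [dvd_iff_eq_zero_of_lt (by omega) (by omega)]
        omega
      rw [if_neg this, map_zero, zero_mul]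
  · refine if_congr ?_ rfl rfl
    rw [Nat.cast_add, add_sub_right_comm, dvd_add_self_right]

end PeriodicSeries

/-- The indicator function of the arc `{0, …, σ - 1}` of `ℤ / p`. -/
def arcInd (p σ : ℕ) (x : ℤ) : ℤ := if x % p < σ then 1 else 0

section ArcInd

variable {p σ : ℕ} {x y d : ℤ}

theorem arcInd_nonneg (p σ : ℕ) (x : ℤ) : 0 ≤ arcInd p σ x := by
  unfold arcInd; split_ifs <;> simp

theorem arcInd_le_one (p σ : ℕ) (x : ℤ) : arcInd p σ x ≤ 1 := by
  unfold arcInd; split_ifs <;> simp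

theorem arcInd_congr (h : (p : ℤ) ∣ x - y) : arcInd p σ x = arcInd p σ y := by
  unfold arcInd
  rw [(Int.modEq_iff_dvd.2 h).eq]

theorem arcInd_of_dvd_sub (h : (p : ℤ) ∣ x - d) (h0 : 0 ≤ d) (hp : d < p) :
    arcInd p σ x = if d < σ then 1 else 0 := by
  rw [arcInd_congr h, arcInd, Int.emod_eq_of_lt h0 hp]

theorem arcInd_sub_arcInd_sub_one (h0 : 0 < σ) (hp : σ < p) (x : ℤ) :
    arcInd p σ x - arcInd p σ (x - 1) =
      (if (p : ℤ) ∣ x then 1 else 0) - if (p : ℤ) ∣ x - σ then 1 else 0 := by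
  obtain ⟨d, hd0, hdp, hd⟩ := exists_dvd_sub_of_pos (by omega : (0 : ℤ) < p) x
  have dvd_iff (m : ℤ) (hm0 : 0 ≤ m) (hmp : m < p) : (p : ℤ) ∣ x - m ↔ d = m := by
    rw [dvd_iff_dvd_of_dvd_sub (by simpa using hd : (p : ℤ) ∣ x - m - (d - m)),
      dvd_iff_eq_zero_of_lt (by omega) (by omega), sub_eq_zero]
  have dvd_x := dvd_iff 0 le_rfl (by omega)
  rw [sub_zero] at dvd_x
  simp only [dvd_x, dvd_iff σ (by omega) (by omega), arcInd_of_dvd_sub hd hd0 hdp]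
  rcases hd0.eq_or_lt with rfl | hd1
  · rw [arcInd_of_dvd_sub (d := p - 1) (by simpa using hd) (by omega) (by omega)]
    split_ifs <;> omega
  · rw [arcInd_of_dvd_sub (d := d - 1) (by simpa using hd) (by omega) (by omega)]
    split_ifs <;> omega

end ArcInd

/-- The coefficient of `x ^ i`, for `0 ≤ i < p q`, in the binary inclusion-exclusion polynomial
`(x ^ (p q) - 1) (x - 1) / ((x ^ p - 1) (x ^ q - 1))`, where `s` is inverse to `q` modulo `p`. The
formula is extended to all `i : ℤ`, where it is `p q`-periodic. -/
def binCoeff (p q s : ℕ) (i : ℤ) : ℤ := arcInd p s (s * i) - arcInd p s (s * i - 1 - i / q)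

/-- The binary inclusion-exclusion polynomial, see `binPoly_mul`. -/
noncomputable def binPoly (p q s : ℕ) : ℤ[X] :=
  ∑ i ∈ Finset.range (p * q), C (binCoeff p q s i) * X ^ i

section Binary

variable {p q s : ℕ}

theorem binCoeff_periodic (hq : 0 < q) : (binCoeff p q s).Periodic (p * q) := by
  intro i
  unfold binCoeff
  rw [Int.add_mul_ediv_right i p (by omega)]
  congr 1 <;> apply arcInd_congr
  · exact ⟨s * q, by ring⟩
  · exact ⟨s * q - 1, by ring⟩

theorem binCoeff_of_neg {i : ℤ} (h0 : -q ≤ i) (hi : i < 0) : binCoeff p q s i = 0 := by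
  have : i / q = -1 := by
    rw [Int.ediv_eq_iff_of_pos (by omega)]
    omega
  rw [binCoeff, this, sub_neg_eq_add, sub_add_cancel, sub_self]

theorem binCoeff_sub_binCoeff_sub (hq : 0 < q) (hs : 0 < s) (hsp : s < p)
    (h : (p : ℤ) ∣ s * q - 1) (i : ℤ) :
    binCoeff p q s i - binCoeff p q s (i - q) =
      (if (p : ℤ) ∣ i then 1 else 0) - if (p : ℤ) ∣ i - 1 then 1 else 0 := by
  have shift : binCoeff p q s (i - q) =
      arcInd p s (s * i - 1) - arcInd p s (s * i - 1 - i / q) := by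
    unfold binCoeff
    rw [Int.sub_ediv_of_dvd i (dvd_refl _), Int.ediv_self (by omega)]
    obtain ⟨c, hc⟩ := h
    congr 1 <;> refine arcInd_congr ⟨-c, ?_⟩ <;> linear_combination -hc
  rw [shift, binCoeff, sub_sub_sub_cancel_right, arcInd_sub_arcInd_sub_one hs hsp,
    show (s * i - s : ℤ) = s * (i - 1) by ring]
  simp only [dvd_mul_iff_of_dvd_mul_sub_one h]

theorem mk_binCoeff_mul_one_sub_X_pow (hq : 0 < q) (hs : 0 < s) (hsp : s < p)
    (h : (p : ℤ) ∣ s * q - 1) :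
    (PowerSeries.mk fun n => binCoeff p q s n) *
        ((1 - PowerSeries.X ^ p) * (1 - PowerSeries.X ^ q)) = 1 - PowerSeries.X := by
  have geom : (PowerSeries.mk fun n => binCoeff p q s n) * (1 - PowerSeries.X ^ q) =
      (PowerSeries.mk fun n : ℕ => if (p : ℤ) ∣ n - (0 : ℕ) then (1 : ℤ) else 0) -
        PowerSeries.mk fun n : ℕ => if (p : ℤ) ∣ n - (1 : ℕ) then (1 : ℤ) else 0 := by
    ext n
    rw [mul_sub, mul_one, map_sub, map_sub, PowerSeries.coeff_mul_X_pow']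
    simp only [PowerSeries.coeff_mk, Nat.cast_zero, Nat.cast_one, sub_zero]
    rw [← binCoeff_sub_binCoeff_sub hq hs hsp h]
    split_ifs with hn
    · rw [Nat.cast_sub hn]
    · rw [binCoeff_of_neg (i := n - q) (by omega) (by omega)]
  rw [mul_left_comm, geom, mul_sub, mul_comm, mk_dvd_sub_mul_one_sub_X_pow (by omega),
    mul_comm, mk_dvd_sub_mul_one_sub_X_pow (by omega), pow_zero, pow_one]

theorem binPoly_mul (hq : 0 < q) (hs : 0 < s) (hsp : s < p)
    (h : (p : ℤ) ∣ s * q - 1) :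
    binPoly p q s * ((1 - X ^ p) * (1 - X ^ q)) = (1 - X) * (1 - X ^ (p * q)) := by
  have periodic : (fun n : ℕ => binCoeff p q s n).Periodic (p * q) := fun n => by
    simpa using binCoeff_periodic (p := p) (s := s) hq n
  apply coe_injective ℤ
  have := mk_binCoeff_mul_one_sub_X_pow hq hs hsp h
  simp only [← coeToPowerSeries.ringHom_apply, map_mul, map_sub, map_one, map_pow]
  simp only [coeToPowerSeries.ringHom_apply, coe_X]
  have coe_binPoly : (binPoly p q s : PowerSeries ℤ) =
      ∑ i ∈ Finset.range (p * q), PowerSeries.C (binCoeff p q s i) * PowerSeries.X ^ i := by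
    rw [binPoly, ← coeToPowerSeries.ringHom_apply, map_sum]
    simp only [map_mul, map_pow, coeToPowerSeries.ringHom_apply, coe_C, coe_X]
  rw [coe_binPoly, ← mk_mul_one_sub_X_pow_of_periodic periodic, ← this]
  ring

end Binary

/-- The coefficient of `x ^ v`, for `v ≥ 0`, in the power series expansion of
`(1 - x ^ p) (1 - x ^ q) / ((1 - x) (1 - x ^ (p q)))`, extended to a `p q`-periodic function. -/
def winCoeff (p q : ℕ) (v : ℤ) : ℤ :=
  ∑ j ∈ Finset.range p, ((if (p * q : ℤ) ∣ v - j then 1 else 0) -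
    if (p * q : ℤ) ∣ v - (j + q) then 1 else 0)

/-- The sum of the terms of index at most `N` in
`∑ i ∈ [0, p q), binCoeff p q s i * winCoeff p q (v - r * i)`. -/
def truncSum (p q r s : ℕ) (N v : ℤ) : ℤ :=
  ∑ i ∈ Finset.range (p * q), (if (i : ℤ) ≤ N then binCoeff p q s i else 0) *
    winCoeff p q (v - r * i)

section Ternary

variable {p q r s : ℕ}

theorem mk_winCoeff_mul_one_sub_X_pow (h : p + q ≤ p * q) :
    (PowerSeries.mk fun n => winCoeff p q n) * (1 - PowerSeries.X ^ (p * q)) =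
      (∑ j ∈ Finset.range p, PowerSeries.X ^ j) * (1 - PowerSeries.X ^ q) := by
  have expand : (PowerSeries.mk fun n => winCoeff p q n) = ∑ j ∈ Finset.range p,
      ((PowerSeries.mk fun n : ℕ => if ((p * q : ℕ) : ℤ) ∣ n - j then (1 : ℤ) else 0) -
        PowerSeries.mk fun n : ℕ =>
          if ((p * q : ℕ) : ℤ) ∣ n - (j + q : ℕ) then (1 : ℤ) else 0) := by
    ext n
    simp [winCoeff]
  rw [expand, Finset.sum_mul, Finset.sum_mul]
  refine Finset.sum_congr rfl fun j hj => ?_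
  rw [Finset.mem_range] at hj
  rw [sub_mul, mk_dvd_sub_mul_one_sub_X_pow (by omega), mk_dvd_sub_mul_one_sub_X_pow (by omega),
    pow_add, mul_sub, mul_one]

theorem Q_mul_one_sub_X_pow (hq : 0 < q) (hr : 0 < r) (hs : 0 < s) (hsp : s < p)
    (h : (p : ℤ) ∣ s * q - 1) (hqr : q.Coprime r) (hrp : r.Coprime p) :
    Q p q r * (1 - X ^ (p * q)) =
      expand ℤ r (binPoly p q s) * ((∑ j ∈ Finset.range p, X ^ j) * (1 - X ^ q)) := by
  have ne_zero : ∀ n : ℕ, 0 < n → (X ^ n - 1 : ℤ[X]) ≠ 0 := fun n hn => by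
    simpa using X_pow_sub_C_ne_zero hn (1 : ℤ)
  have hX : (X - 1 : ℤ[X]) ≠ 0 := by simpa using ne_zero 1 one_pos
  have hQ := Q_mul_den (by omega) hq hr (coprime_of_dvd_mul_sub_one h) hqr hrp
  have hB := congrArg (expand ℤ r) (binPoly_mul hq hs hsp h)
  have hS := geom_sum_mul (X : ℤ[X]) p
  simp only [map_mul, map_sub, map_one, map_pow, expand_X, ← pow_mul] at hB
  unfold num den at hQ
  apply mul_right_cancel₀ (mul_ne_zero (mul_ne_zero (ne_zero (q * r) (by positivity))
    (ne_zero (r * p) (Nat.mul_pos hr (hs.trans hsp)))) hX)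
  rw [mul_comm r (p * q), mul_comm r q] at hB
  linear_combination -hQ - (X ^ p - 1) * (1 - X ^ q) * hB -
    expand ℤ r (binPoly p q s) * (1 - X ^ q) * (X ^ (q * r) - 1) * (X ^ (r * p) - 1) * hS

theorem coe_Q (hq : 1 < q) (hr : 0 < r) (hs : 0 < s) (hsp : s < p)
    (h : (p : ℤ) ∣ s * q - 1) (hqr : q.Coprime r) (hrp : r.Coprime p) :
    (Q p q r : PowerSeries ℤ) =
      expand ℤ r (binPoly p q s) * PowerSeries.mk fun n => winCoeff p q n := by
  have one_sub_ne_zero : (1 - PowerSeries.X ^ (p * q) : PowerSeries ℤ) ≠ 0 := fun h0 => by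
    have hpq : p * q ≠ 0 := Nat.mul_ne_zero (by omega) (by omega)
    simpa [-mul_eq_zero, hpq] using congrArg PowerSeries.constantCoeff h0
  have hQ := congrArg (coeToPowerSeries.ringHom (R := ℤ))
    (Q_mul_one_sub_X_pow (by omega) hr hs hsp h hqr hrp)
  simp only [map_mul, map_sub, map_one, map_pow, map_sum] at hQ
  simp only [coeToPowerSeries.ringHom_apply, coe_X] at hQ
  apply mul_right_cancel₀ one_sub_ne_zero
  rw [hQ, mul_assoc, mk_winCoeff_mul_one_sub_X_pow (Nat.add_le_mul (by omega) hq)]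

theorem coeff_Q (hq : 1 < q) (hr : 0 < r) (hs : 0 < s) (hsp : s < p)
    (h : (p : ℤ) ∣ s * q - 1) (hqr : q.Coprime r) (hrp : r.Coprime p)
    (n : ℕ) : (Q p q r).coeff n = truncSum p q r s (n / r) n := by
  have coe_expand_binPoly : (expand ℤ r (binPoly p q s) : PowerSeries ℤ) =
      ∑ i ∈ Finset.range (p * q), PowerSeries.C (binCoeff p q s i) * PowerSeries.X ^ (r * i) := by
    rw [binPoly, ← coeToPowerSeries.ringHom_apply, map_sum, map_sum]
    simp only [map_mul, map_pow, expand_C, expand_X, pow_mul, coeToPowerSeries.ringHom_apply, coe_C,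
      coe_X]
  rw [← coeff_coe, coe_Q hq hr hs hsp h hqr hrp, coe_expand_binPoly, Finset.sum_mul, map_sum]
  refine Finset.sum_congr rfl fun i _ => ?_
  have mul_le_iff : (i : ℤ) ≤ n / r ↔ r * i ≤ n := by
    rw [Int.le_ediv_iff_mul_le (by omega), mul_comm r]
    norm_cast
  rw [mul_assoc, PowerSeries.coeff_C_mul, PowerSeries.coeff_X_pow_mul', PowerSeries.coeff_mk]
  simp only [mul_le_iff]
  split_ifs with hi
  · rw [Nat.cast_sub hi, Nat.cast_mul]
  · rw [mul_zero, zero_mul]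

end Ternary

section CoeffSet

variable {p q r s : ℕ}

theorem winCoeff_congr {v w : ℤ} (h : (p * q : ℤ) ∣ v - w) :
    winCoeff p q v = winCoeff p q w := by
  have (m : ℤ) : (p * q : ℤ) ∣ v - m ↔ (p * q : ℤ) ∣ w - m :=
    dvd_iff_dvd_of_dvd_sub (by rwa [sub_sub_sub_cancel_right])
  simp only [winCoeff, this]

theorem winCoeff_reflect (v : ℤ) : winCoeff p q (p + q - 1 - v) = -winCoeff p q v := by
  rw [winCoeff, ← Finset.sum_range_reflect, winCoeff, ← Finset.sum_neg_distrib]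
  refine Finset.sum_congr rfl fun j hj => ?_
  rw [Finset.mem_range] at hj
  have cast : ((p - 1 - j : ℕ) : ℤ) = p - 1 - j := by omega
  have reflect_first : (p + q - 1 - v - (p - 1 - j) : ℤ) = -(v - (j + q)) := by ring
  have reflect_second : (p + q - 1 - v - (p - 1 - j + q) : ℤ) = -(v - j) := by ring
  rw [cast, reflect_first, reflect_second]
  simp only [dvd_neg, neg_sub (ite _ _ _)]

theorem winCoeff_eq_zero {v : ℤ} (hq : 0 < q) (hv : p + q ≤ v + p * q)
    (h : v < 0 ∨ p ≤ v ∧ v < q) : winCoeff p q v = 0 := by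
  refine Finset.sum_eq_zero fun j hj => ?_
  rw [Finset.mem_range] at hj
  have hM : (q : ℤ) ≤ p * q := le_mul_of_one_le_left (by omega) (by omega)
  have not_dvd : ∀ x : ℤ, -(p * q) < x → x < p * q → x ≠ 0 → ¬ (p * q : ℤ) ∣ x :=
    fun x h1 h2 => mt (dvd_iff_eq_zero_of_lt h1 h2).1
  rw [if_neg (not_dvd _ (by omega) (by omega) (by omega)),
    if_neg (not_dvd _ (by omega) (by omega) (by omega)), sub_zero]

theorem truncSum_congr {N v w : ℤ} (h : (p * q : ℤ) ∣ v - w) :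
    truncSum p q r s N v = truncSum p q r s N w := by
  have (i : ℤ) : winCoeff p q (v - r * i) = winCoeff p q (w - r * i) :=
    winCoeff_congr (by rwa [sub_sub_sub_cancel_right])
  simp only [truncSum, this]

theorem truncSum_reflect {r' : ℕ} (h : p * q ∣ r + r') (N v : ℤ) :
    truncSum p q r' s N v = -truncSum p q r s N (p + q - 1 - v) := by
  rw [truncSum, truncSum, ← Finset.sum_neg_distrib]
  refine Finset.sum_congr rfl fun i _ => ?_
  rw [← mul_neg, ← winCoeff_reflect]
  congr 1
  apply winCoeff_congr
  obtain ⟨c, hc⟩ := h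
  zify at hc
  exact ⟨-(c * i), by linear_combination -(i : ℤ) * hc⟩

theorem truncSum_ediv_eq {N n : ℤ} (hr : p + q ≤ r) (h0 : (N + 1) * r - p * q ≤ n)
    (h1 : n < (N + 1) * r) : truncSum p q r s (n / r) n = truncSum p q r s N n := by
  refine Finset.sum_congr rfl fun i hi => ?_
  have hM : 0 < p * q := (Nat.zero_le i).trans_lt (Finset.mem_range.1 hi)
  have hq : 0 < q := Nat.pos_of_mul_pos_left hM
  rcases le_or_gt (i : ℤ) (n / r) with hin | hin
  · have : n / r < N + 1 := (Int.ediv_lt_iff_lt_mul (by omega)).2 h1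
    rw [if_pos hin, if_pos (by omega)]
  · rw [if_neg hin.not_ge]
    split_ifs with hiN
    · rw [Int.ediv_lt_iff_lt_mul (by omega)] at hin
      have : (i : ℤ) * r ≤ N * r := mul_le_mul_of_nonneg_right hiN (by omega)
      rw [winCoeff_eq_zero hq (by linarith) (Or.inl (by linarith)), zero_mul, mul_zero]
    · rfl

theorem mem_coeffSet {a : ℤ} : a ∈ coeffSet p q r ↔ ∃ m ≤ phi p q r, (Q p q r).coeff m = a := by
  simp only [coeffSet, Finset.mem_image, Finset.mem_range, Nat.lt_succ_iff]

theorem zero_mem_coeffSet (hpq : p < q) (hr : p + q ≤ r) (hs : 0 < s) (hsp : s < p)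
    (h : (p : ℤ) ∣ s * q - 1) (hqr : q.Coprime r) (hrp : r.Coprime p) : 0 ∈ coeffSet p q r := by
  refine mem_coeffSet.2 ⟨p, ?_, ?_⟩
  · calc p ≤ r - 1 := by omega
      _ ≤ phi p q r := Nat.le_mul_of_pos_left _ (Nat.mul_pos (by omega) (by omega))
  · rw [coeff_Q (by omega) (by omega) hs hsp h hqr hrp]
    refine Finset.sum_eq_zero fun i _ => ?_
    rw [Int.ediv_eq_zero_of_lt (by omega) (by omega)]
    rcases i.eq_zero_or_pos with rfl | hi
    · have := Nat.add_le_mul (by omega : 2 ≤ p) (by omega : 2 ≤ q)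
      rw [winCoeff_eq_zero (by omega) (by zify at this; simp; omega)
        (Or.inr (by simpa using hpq)), mul_zero]
    · rw [if_neg (by omega), zero_mul]

/-- Cutting the sum at `N` costs nothing: within the residue class of `v` modulo `p q` there is an
index `n` for which `truncSum` of `n` stops at `N` by itself. -/
theorem mem_coeffSet_iff (hpq : p < q) (hr : p + q ≤ r) (hs : 0 < s) (hsp : s < p)
    (h : (p : ℤ) ∣ s * q - 1) (hqr : q.Coprime r) (hrp : r.Coprime p) {a : ℤ} :
    a ∈ coeffSet p q r ↔ ∃ N v : ℤ, truncSum p q r s N v = a := by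
  have hcoeff := coeff_Q (by omega) (by omega) hs hsp h hqr hrp
  rw [mem_coeffSet]
  constructor
  · rintro ⟨m, -, rfl⟩
    exact ⟨_, _, (hcoeff m).symm⟩
  rintro ⟨N, v, rfl⟩
  obtain ⟨n, hn0, hn1, hvn⟩ : ∃ n, (N + 1) * r - p * q ≤ n ∧ n < (N + 1) * r ∧
      (p * q : ℤ) ∣ v - n := by
    obtain ⟨d, hd0, hd1, hd⟩ := exists_dvd_sub_of_pos (M := p * q)
      (mul_pos (by omega) (by omega)) (v - (N + 1) * r)
    exact ⟨d + (N + 1) * r - p * q, by linarith, by linarith,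
      by obtain ⟨c, hc⟩ := hd; exact ⟨c + 1, by linear_combination hc⟩⟩
  rw [truncSum_congr hvn, ← truncSum_ediv_eq hr hn0 hn1]
  have zero_mem := mem_coeffSet.1 (zero_mem_coeffSet hpq hr hs hsp h hqr hrp)
  rcases lt_or_ge n 0 with hn | hn
  · have : n / r < 0 := Int.ediv_neg_of_neg_of_pos hn (by omega)
    convert zero_mem
    exact Finset.sum_eq_zero fun i _ => by rw [if_neg (by omega), zero_mul]
  lift n to ℕ using hn
  rw [← hcoeff]
  rcases le_or_gt n (phi p q r) with hn | hn
  · exact ⟨n, hn, rfl⟩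
  · rwa [coeff_eq_zero_of_natDegree_lt]
    rwa [natDegree_Q (by omega) (by omega) (by omega)]

theorem coeffSet_eq_image_neg {r' : ℕ} (hpq : p < q) (hs : 0 < s) (hsp : s < p)
    (h : (p : ℤ) ∣ s * q - 1) (hr : p + q ≤ r) (hqr : q.Coprime r) (hrp : r.Coprime p)
    (hr' : p + q ≤ r') (hqr' : q.Coprime r') (hrp' : r'.Coprime p) (hrr' : p * q ∣ r + r') :
    coeffSet p q r' = (coeffSet p q r).image (fun a => -a) := by
  ext a
  simp only [Finset.mem_image, mem_coeffSet_iff hpq hr hs hsp h hqr hrp,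
    mem_coeffSet_iff hpq hr' hs hsp h hqr' hrp']
  constructor
  · rintro ⟨N, v, rfl⟩
    exact ⟨_, ⟨N, p + q - 1 - v, rfl⟩, (truncSum_reflect hrr' N v).symm⟩
  · rintro ⟨_, ⟨N, v, rfl⟩, rfl⟩
    refine ⟨N, p + q - 1 - v, ?_⟩
    rw [truncSum_reflect hrr', sub_sub_cancel]

end CoeffSet

/-- The coefficient `binCoeff p q s z`, cut off to `0` if the residue of `z` modulo `p q`
exceeds `N`. -/
def cutCoeff (p q s : ℕ) (N z : ℤ) : ℤ := if z % (p * q) ≤ N then binCoeff p q s z else 0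

/-- The sum of the cut coefficients along the progression `w, w - t, …, w - t (p - 1)`. -/
def cutSum (p q s t : ℕ) (N w : ℤ) : ℤ := ∑ j ∈ Finset.range p, cutCoeff p q s N (w - t * j)

/-- The difference of two cut sums which gives the coefficients of `Q p q r` when `t` is inverse
to `r` modulo `p q`, see `mem_coeffSet_iff_cutDiff`. -/
def cutDiff (p q s t : ℕ) (N w : ℤ) : ℤ := cutSum p q s t N w - cutSum p q s t N (w - t * q)

section CutDiff

variable {p q r s t : ℕ}

theorem sum_range_mul_ite_dvd {M : ℕ} (hM : 0 < M) (f : ℤ → ℤ) (u : ℤ) :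
    ∑ i ∈ Finset.range M, f i * (if (M : ℤ) ∣ u - i then 1 else 0) = f (u % M) := by
  obtain ⟨d, hd0, hd1, hd⟩ := exists_dvd_sub_of_pos (by omega : (0 : ℤ) < M) u
  lift d to ℕ using hd0
  rw [(Int.modEq_iff_dvd.2 hd).symm.eq, Int.emod_eq_of_lt (by omega) hd1,
    Finset.sum_eq_single_of_mem d (Finset.mem_range.2 (by omega)) fun i hi hne => ?_]
  · rw [if_pos hd, mul_one]
  · have : ¬ (M : ℤ) ∣ u - i := by
      rw [Finset.mem_range] at hi
      rw [dvd_iff_dvd_of_dvd_sub (by simpa using hd : (M : ℤ) ∣ u - i - (d - i)),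
        dvd_iff_eq_zero_of_lt (by omega) (by omega)]
      omega
    rw [if_neg this, mul_zero]

theorem cutCoeff_periodic (hq : 0 < q) (N : ℤ) : (cutCoeff p q s N).Periodic (p * q) := fun z => by
  rw [cutCoeff, cutCoeff, Int.add_emod_right, binCoeff_periodic hq]

theorem truncSum_eq_cutDiff (hp : 0 < p) (hq : 0 < q) (h : (p * q : ℤ) ∣ r * t - 1) (N v : ℤ) :
    truncSum p q r s N v = cutDiff p q s t N (t * v) := by
  have sum_eq (m : ℤ) : ∑ i ∈ Finset.range (p * q), (if (i : ℤ) ≤ N then binCoeff p q s i else 0) *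
      (if (p * q : ℤ) ∣ v - r * i - m then 1 else 0) = cutCoeff p q s N (t * v - t * m) := by
    have dvd_iff (i : ℕ) : (p * q : ℤ) ∣ v - r * i - m ↔ ((p * q : ℕ) : ℤ) ∣ t * v - t * m - i := by
      rw [← dvd_mul_iff_of_dvd_mul_sub_one (mul_comm (r : ℤ) t ▸ h), Nat.cast_mul]
      obtain ⟨c, hc⟩ := h
      exact dvd_iff_dvd_of_dvd_sub ⟨-(c * i), by linear_combination -(i : ℤ) * hc⟩
    simp only [dvd_iff]
    rw [sum_range_mul_ite_dvd (Nat.mul_pos hp hq) fun i => if i ≤ N then binCoeff p q s i else 0,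
      cutCoeff, Nat.cast_mul,
      ← eq_of_periodic_of_dvd_sub (binCoeff_periodic hq) Int.dvd_self_sub_emod]
  simp only [truncSum, winCoeff, Finset.mul_sum]
  rw [Finset.sum_comm, cutDiff, cutSum, cutSum, ← Finset.sum_sub_distrib]
  refine Finset.sum_congr rfl fun j _ => ?_
  simp only [mul_sub, Finset.sum_sub_distrib, sum_eq]
  ring_nf

theorem cutSum_periodic (hq : 0 < q) (N : ℤ) : (cutSum p q s t N).Periodic (p * q) := fun w => by
  simp only [cutSum, add_sub_right_comm w (p * q : ℤ), cutCoeff_periodic hq N _]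

theorem cutDiff_periodic (hq : 0 < q) (N : ℤ) : (cutDiff p q s t N).Periodic (p * q) := fun w => by
  simp only [cutDiff, add_sub_right_comm w (p * q : ℤ), cutSum_periodic hq N _]

theorem mem_coeffSet_iff_cutDiff (hpq : p < q) (hr : p + q ≤ r) (hs : 0 < s) (hsp : s < p)
    (h : (p : ℤ) ∣ s * q - 1) (hqr : q.Coprime r) (hrp : r.Coprime p)
    (hrt : (p * q : ℤ) ∣ r * t - 1) {a : ℤ} :
    a ∈ coeffSet p q r ↔ ∃ N w : ℤ, cutDiff p q s t N w = a := by
  have hcut := truncSum_eq_cutDiff (s := s) (hs.trans hsp) (by omega : 0 < q) hrt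
  simp only [mem_coeffSet_iff hpq hr hs hsp h hqr hrp, hcut]
  refine exists_congr fun N => ⟨fun ⟨v, hv⟩ => ⟨_, hv⟩, fun ⟨w, hw⟩ => ⟨r * w, ?_⟩⟩
  rw [← hw]
  obtain ⟨c, hc⟩ := hrt
  exact eq_of_periodic_of_dvd_sub (cutDiff_periodic (by omega) N)
    ⟨c * w, by linear_combination w * hc⟩

end CutDiff

section ArcSum

variable {p σ : ℕ}

theorem sum_range_arcInd (hσ : σ ≤ p) (c : ℤ) : ∑ j ∈ Finset.range p, arcInd p σ (c - j) = σ := by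
  rcases p.eq_zero_or_pos with rfl | hp
  · simp [Nat.le_zero.1 hσ]
  have periodic : (fun c : ℤ => ∑ j ∈ Finset.range p, arcInd p σ (c - j)).Periodic 1 := by
    intro c
    have wrap : arcInd p σ (c + 1 - p) = arcInd p σ (c + 1 - (0 : ℕ)) :=
      arcInd_congr ⟨-1, by push_cast; ring⟩
    have hsucc := Finset.sum_range_succ (fun j : ℕ => arcInd p σ (c + 1 - j)) p
    rw [Finset.sum_range_succ', wrap, add_right_cancel_iff] at hsucc
    simp only [← hsucc, Nat.cast_add_one, add_sub_add_right_eq_sub]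
  calc ∑ j ∈ Finset.range p, arcInd p σ (c - j)
      = ∑ j ∈ Finset.range p, arcInd p σ ((p - 1 : ℕ) - j) :=
        eq_of_periodic_of_dvd_sub periodic (one_dvd _)
    _ = ∑ j ∈ Finset.range p, if j < σ then 1 else 0 := by
        rw [← Finset.sum_range_reflect]
        refine Finset.sum_congr rfl fun j hj => ?_
        rw [Finset.mem_range] at hj
        have : ((p - 1 : ℕ) - (p - 1 - j : ℕ) : ℤ) = j := by omega
        rw [this, arcInd_of_dvd_sub (d := j) (by simp) (by omega) (by omega)]
        simp only [Nat.cast_lt]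
    _ = σ := by
        have : {j ∈ Finset.range p | j < σ} = Finset.range σ := by
          ext j
          simp only [Finset.mem_filter, Finset.mem_range]
          omega
        rw [Finset.sum_boole, this, Finset.card_range]

theorem sum_Ico_arcInd_nonneg (c : ℤ) (x y : ℕ) :
    0 ≤ ∑ j ∈ Finset.Ico x y, arcInd p σ (c - j) :=
  Finset.sum_nonneg fun _ _ => arcInd_nonneg _ _ _

theorem sum_Ico_arcInd_le (hσ : σ ≤ p) (c : ℤ) {x y : ℕ} (hxy : y ≤ x + p) :
    ∑ j ∈ Finset.Ico x y, arcInd p σ (c - j) ≤ σ :=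
  calc ∑ j ∈ Finset.Ico x y, arcInd p σ (c - j)
      ≤ ∑ j ∈ Finset.Ico x (x + p), arcInd p σ (c - j) :=
        Finset.sum_le_sum_of_subset_of_nonneg (Finset.Ico_subset_Ico_right hxy)
          fun _ _ _ => arcInd_nonneg _ _ _
    _ = ∑ j ∈ Finset.range p, arcInd p σ (c - x - j) := by
        rw [Finset.sum_Ico_eq_sum_range, Nat.add_sub_cancel_left]
        simp only [Nat.cast_add, sub_sub]
    _ = σ := sum_range_arcInd hσ _

theorem exists_arc_of_le_sum (h0 : 0 < σ) (hσ : σ ≤ p) {c : ℤ} {x y : ℕ} (hxy : y < x + p)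
    (h : σ ≤ ∑ j ∈ Finset.Ico x y, arcInd p σ (c - j)) :
    ∃ i : ℕ, x ≤ i ∧ i + σ ≤ y ∧ (p : ℤ) ∣ c - i - (σ - 1) := by
  obtain ⟨d, hd0, hdp, hd⟩ := exists_dvd_sub_of_pos (by omega : (0 : ℤ) < p) (c - (σ - 1) - x)
  lift d to ℕ using hd0
  have dvd : (p : ℤ) ∣ c - (x + d : ℕ) - (σ - 1) := by
    convert hd using 1
    push_cast
    ring
  refine ⟨x + d, by omega, ?_, dvd⟩
  by_contra! hy
  obtain ⟨n, hdn, hyn, hnd, hnx⟩ : ∃ n, x + d ≤ n ∧ y ≤ n ∧ n < x + d + σ ∧ n < x + p :=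
    ⟨max (x + d) y, le_max_left _ _, le_max_right _ _, by omega, by omega⟩
  have value : arcInd p σ (c - n) = 1 := by
    rw [arcInd_of_dvd_sub (d := σ - 1 - (n - (x + d : ℕ))) _ (by omega) (by omega),
      if_pos (by omega)]
    convert dvd using 1
    ring
  have window : ∑ j ∈ Finset.Ico x (n + 1), arcInd p σ (c - j) ≤ σ :=
    sum_Ico_arcInd_le hσ c (by omega)
  rw [Finset.sum_Ico_succ_top (by omega), value] at window
  have mono : ∑ j ∈ Finset.Ico x y, arcInd p σ (c - j) ≤
      ∑ j ∈ Finset.Ico x n, arcInd p σ (c - j) :=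
    Finset.sum_le_sum_of_subset_of_nonneg (Finset.Ico_subset_Ico_right hyn)
      fun _ _ _ => arcInd_nonneg _ _ _
  omega

theorem sum_Ico_delayed_of_le_or_le {f : ℤ → ℤ} (c : ℤ) {J x y : ℕ} (hJ : J ≤ x ∨ y ≤ J) :
    ∃ c' : ℤ, ∑ j ∈ Finset.Ico x y, f (c - j + if J ≤ j then 1 else 0) =
      ∑ j ∈ Finset.Ico x y, f (c' - j) := by
  rcases hJ with hJ | hJ
  · refine ⟨c + 1, Finset.sum_congr rfl fun j hj => ?_⟩
    rw [if_pos (hJ.trans (Finset.mem_Ico.1 hj).1), sub_add_eq_add_sub]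
  · refine ⟨c, Finset.sum_congr rfl fun j hj => ?_⟩
    rw [if_neg ((Finset.mem_Ico.1 hj).2.trans_le hJ).not_ge, add_zero]

theorem sum_Ico_delayed {f : ℤ → ℤ} (c : ℤ) {J x y : ℕ} (hx : x ≤ J) (hy : J < y) :
    ∑ j ∈ Finset.Ico x y, f (c - j + if J ≤ j then 1 else 0) =
      ∑ j ∈ Finset.Ico x (y - 1), f (c - j) + f (c - J + 1) := by
  obtain ⟨y, rfl⟩ : ∃ z, y = z + 1 := ⟨y - 1, by omega⟩
  have before : ∑ j ∈ Finset.Ico x J, f (c - j + if J ≤ j then 1 else 0) =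
      ∑ j ∈ Finset.Ico x J, f (c - j) :=
    Finset.sum_congr rfl fun j hj => by
      rw [if_neg (Finset.mem_Ico.1 hj).2.not_ge, add_zero]
  have after : ∑ j ∈ Finset.Ico (J + 1) (y + 1), f (c - j + if J ≤ j then 1 else 0) =
      ∑ j ∈ Finset.Ico J y, f (c - j) := by
    rw [← Finset.sum_Ico_add' _ J y 1]
    refine Finset.sum_congr rfl fun j hj => ?_
    rw [if_pos (by have := Finset.mem_Ico.1 hj; omega)]
    push_cast
    ring_nf
  rw [Nat.add_sub_cancel, ← Finset.sum_Ico_consecutive _ hx hy.le,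
    Finset.sum_eq_sum_Ico_succ_bot hy, before, after, if_pos le_rfl,
    ← Finset.sum_Ico_consecutive _ hx (Nat.lt_succ_iff.1 hy)]
  ring

/-- The number of `j ∈ [x, y)` with `α - j` in the arc `{0, …, σ - 1}` of `ℤ / p`, minus the number
of those with `α - j - 1 - e` in the arc, where the second progression repeats a value at
`j = J`. Windows of binary coefficients have this shape. -/
def arcSum (p σ : ℕ) (α e : ℤ) (J x y : ℕ) : ℤ :=
  ∑ j ∈ Finset.Ico x y,
    (arcInd p σ (α - j) - arcInd p σ (α - 1 - e - j + if J ≤ j then 1 else 0))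

theorem arcSum_le (hσ : σ ≤ p) (α e : ℤ) (J : ℕ) {x y : ℕ} (hxy : y ≤ x + p) :
    arcSum p σ α e J x y ≤ σ :=
  (Finset.sum_le_sum fun _ _ => sub_le_self _ (arcInd_nonneg _ _ _)).trans
    (sum_Ico_arcInd_le hσ α hxy)

theorem neg_le_arcSum (hσ : σ ≤ p) {α e : ℤ} {J x y : ℕ} (hxy : y ≤ x + p)
    (hJ : J ≤ x ∨ y ≤ J) : -σ ≤ arcSum p σ α e J x y := by
  obtain ⟨c, hc⟩ := sum_Ico_delayed_of_le_or_le (f := arcInd p σ) (α - 1 - e) hJ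
  rw [arcSum, Finset.sum_sub_distrib, hc]
  linarith [sum_Ico_arcInd_le hσ c hxy, sum_Ico_arcInd_nonneg (p := p) (σ := σ) α x y]

theorem neg_sub_one_le_arcSum (hσ : σ ≤ p) (α e : ℤ) (J : ℕ) {x y : ℕ} (hxy : y ≤ x + p) :
    -σ - 1 ≤ arcSum p σ α e J x y := by
  by_cases hJ : J ≤ x ∨ y ≤ J
  · linarith [neg_le_arcSum hσ hxy hJ (α := α) (e := e)]
  push Not at hJ
  rw [arcSum, Finset.sum_sub_distrib, sum_Ico_delayed _ hJ.1.le hJ.2]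
  linarith [sum_Ico_arcInd_nonneg (p := p) (σ := σ) α x y, arcInd_le_one p σ (α - 1 - e - J + 1),
    sum_Ico_arcInd_le hσ (α - 1 - e) (by omega : y - 1 ≤ x + p)]

theorem of_arcSum_le (h0 : 0 < σ) (hσ : σ ≤ p) {α e : ℤ} {J x y : ℕ} (hy : y ≤ p) (he : 0 ≤ e)
    (hep : e < p) (h : arcSum p σ α e J x y ≤ -σ - 1) :
    σ ≤ e ∧ e + σ < p ∧ arcInd p σ (α - e - J) = 1 := by
  by_cases hJ : J ≤ x ∨ y ≤ J
  · linarith [neg_le_arcSum hσ (by omega) hJ (α := α) (e := e) (y := y)]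
  push Not at hJ
  rw [arcSum, Finset.sum_sub_distrib, sum_Ico_delayed _ hJ.1.le hJ.2] at h
  have first_nonneg := sum_Ico_arcInd_nonneg (p := p) (σ := σ) α x y
  have second_le := sum_Ico_arcInd_le hσ (α - 1 - e) (by omega : y - 1 ≤ x + p)
  have repeated_le := arcInd_le_one p σ (α - 1 - e - J + 1)
  obtain ⟨i, hxi, hiy, hi⟩ := exists_arc_of_le_sum h0 hσ (c := α - 1 - e) (x := x) (y := y - 1)
    (by omega) (by linarith)
  have first_eq_zero : ∀ j ∈ Finset.Ico x y, arcInd p σ (α - j) = 0 :=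
    (Finset.sum_eq_zero_iff_of_nonneg fun _ _ => arcInd_nonneg _ _ _).1 (by linarith)
  have not_arc (j : ℕ) (d : ℤ) (hxj : x ≤ j) (hjy : j < y) (hd : 0 ≤ d) (hdσ : d < σ) :
      ¬ (p : ℤ) ∣ α - j - d := fun hj => by
    have := first_eq_zero j (Finset.mem_Ico.2 ⟨hxj, hjy⟩)
    rw [arcInd_of_dvd_sub hj hd (by omega), if_pos hdσ] at this
    exact one_ne_zero this
  obtain ⟨m, hm⟩ := hi
  refine ⟨?_, ?_, ?_⟩
  · by_contra! hlt
    exact not_arc (i + σ) e (by omega) (by omega) he hlt ⟨m, by push_cast; linear_combination hm⟩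
  · by_contra! hge
    exact not_arc i (e + σ - p) (by omega) (by omega) (by omega) (by omega)
      ⟨m + 1, by linear_combination hm⟩
  · rw [show α - e - J = α - 1 - e - J + 1 by ring]
    linarith

theorem arcSum_range_eq_zero (hσ : σ ≤ p) (α e : ℤ) {J : ℕ} (hJ : p ≤ J) :
    arcSum p σ α e J 0 p = 0 := by
  rw [arcSum, ← Finset.range_eq_Ico, Finset.sum_sub_distrib, sum_range_arcInd hσ, sub_eq_zero,
    ← sum_range_arcInd hσ (α - 1 - e)]
  refine Finset.sum_congr rfl fun j hj => ?_
  rw [if_neg ((Finset.mem_range.1 hj).trans_le hJ).not_ge, add_zero]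

theorem arcSum_eq_neg_sub_one (hσ : 2 * σ < p) {α : ℤ} {J : ℕ} (hα : (p : ℤ) ∣ α - (σ - 1))
    (hJ : p ≤ J + σ) (hJp : J < p) : arcSum p σ α σ J σ p = -σ - 1 := by
  refine le_antisymm ?_ (neg_sub_one_le_arcSum (by omega) α σ J (by omega))
  obtain ⟨m, hm⟩ := hα
  have first : ∑ j ∈ Finset.Ico σ p, arcInd p σ (α - j) = 0 := by
    refine Finset.sum_eq_zero fun j hj => ?_
    rw [Finset.mem_Ico] at hj
    rw [arcInd_of_dvd_sub (d := p + σ - 1 - j) ⟨m - 1, by linear_combination hm⟩ (by omega)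
      (by omega), if_neg (by omega)]
  have second (j : ℕ) (hj : p - 1 - σ ≤ j) (hjp : j < p - 1) :
      arcInd p σ (α - 1 - σ - j) = 1 := by
    rw [arcInd_of_dvd_sub (d := p - 2 - j) ⟨m - 1, by linear_combination hm⟩ (by omega)
      (by omega), if_pos (by omega)]
  have repeated : arcInd p σ (α - 1 - σ - J + 1) = 1 := by
    rw [arcInd_of_dvd_sub (d := p - 1 - J) ⟨m - 1, by linear_combination hm⟩ (by omega)
      (by omega), if_pos (by omega)]
  have second_ge : (σ : ℤ) ≤ ∑ j ∈ Finset.Ico σ (p - 1), arcInd p σ (α - 1 - σ - j) :=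
    calc (σ : ℤ) = ∑ j ∈ Finset.Ico (p - 1 - σ) (p - 1), 1 := by
          rw [Finset.sum_const, Nat.card_Ico, nsmul_one]
          omega
      _ = ∑ j ∈ Finset.Ico (p - 1 - σ) (p - 1), arcInd p σ (α - 1 - σ - j) :=
          Finset.sum_congr rfl fun j hj =>
            (second j (Finset.mem_Ico.1 hj).1 (Finset.mem_Ico.1 hj).2).symm
      _ ≤ ∑ j ∈ Finset.Ico σ (p - 1), arcInd p σ (α - 1 - σ - j) :=
          Finset.sum_le_sum_of_subset_of_nonneg (Finset.Ico_subset_Ico_left (by omega))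
            fun _ _ _ => arcInd_nonneg _ _ _
  rw [arcSum, Finset.sum_sub_distrib, sum_Ico_delayed _ (by omega) hJp, first, repeated]
  linarith

theorem arcSum_eq_neg (hσ : 2 * σ ≤ p) {α : ℤ} {J : ℕ} (hα : (p : ℤ) ∣ α - (σ - 1))
    (hJ : p ≤ J) : arcSum p σ α (σ - 1) J (p - σ) p = -σ := by
  obtain ⟨m, hm⟩ := hα
  have summand : ∀ j ∈ Finset.Ico (p - σ) p, arcInd p σ (α - j) -
      arcInd p σ (α - 1 - (σ - 1) - j + if J ≤ j then 1 else 0) = -1 := by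
    intro j hj
    rw [Finset.mem_Ico] at hj
    rw [if_neg (by omega : ¬ J ≤ j), add_zero,
      arcInd_of_dvd_sub (d := p + σ - 1 - j) ⟨m - 1, by linear_combination hm⟩ (by omega)
        (by omega), if_neg (by omega),
      arcInd_of_dvd_sub (d := p - 1 - j) ⟨m - 1, by linear_combination hm⟩ (by omega)
        (by omega), if_pos (by omega), zero_sub]
  rw [arcSum, Finset.sum_congr rfl summand, Finset.sum_const, Nat.card_Ico, nsmul_eq_mul]
  have : ((p - (p - σ) : ℕ) : ℤ) = σ := by omega
  rw [this, mul_neg_one]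

theorem arcInd_eq_one_sub_arcInd {τ : ℕ} (h : σ + τ = p) (hτ : 0 < p) (x : ℤ) :
    arcInd p σ x = 1 - arcInd p τ (x - σ) := by
  obtain ⟨d, hd0, hdp, m, hm⟩ := exists_dvd_sub_of_pos (by omega : (0 : ℤ) < p) x
  rw [arcInd_of_dvd_sub ⟨m, hm⟩ hd0 hdp]
  by_cases hd : d < σ
  · rw [arcInd_of_dvd_sub (d := d - σ + p) ⟨m - 1, by linear_combination hm⟩ (by omega) (by omega),
      if_pos hd, if_neg (by omega), sub_zero]
  · rw [arcInd_of_dvd_sub (d := d - σ) ⟨m, by linear_combination hm⟩ (by omega) (by omega),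
      if_neg hd, if_pos (by omega), sub_self]

end ArcSum

theorem exists_threshold {t : ℕ} (ht : 0 < t) (N w : ℤ) (n : ℕ) :
    ∃ κ ≤ n, ∀ j < n, w - t * j ≤ N ↔ κ ≤ j := by
  refine ⟨min n (-((N - w) / t)).toNat, min_le_left _ _, fun j hj => ?_⟩
  have le_iff : -(j : ℤ) ≤ (N - w) / t ↔ -j * (t : ℤ) ≤ N - w :=
    Int.le_ediv_iff_mul_le (by omega)
  rw [neg_mul, mul_comm] at le_iff
  omega

/-- The sum of the binary coefficients with indices `w - t j`, `j ∈ [x, y)`. -/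
def winSum (p q s t : ℕ) (w : ℤ) (x y : ℕ) : ℤ :=
  ∑ j ∈ Finset.Ico x y, binCoeff p q s (w - t * j)

/-- The first `j` for which `w - t j` lies in a lower block `[q e, q (e + 1))` than `w`. -/
def breakIdx (q t : ℕ) (w : ℤ) : ℕ := (w % q / t).toNat + 1

/-- Parameters for which `s` and `t` are mutually inverse residues modulo `p`, with `q ≡ t`. The
bound `t p < q` makes a progression of `p` terms with step `t` shorter than a block
`[q e, q (e + 1))`. -/
structure Admissible (p q s t : ℕ) : Prop where
  s_pos : 0 < s
  s_lt : s < p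
  t_pos : 0 < t
  t_lt : t < p
  dvd_st : (p : ℤ) ∣ s * t - 1
  dvd_qt : (p : ℤ) ∣ q - t
  mul_lt : t * p < q

namespace Admissible

variable {p q s t : ℕ} (h : Admissible p q s t)
include h

theorem dvd_sq : (p : ℤ) ∣ s * q - 1 := by
  rw [show (s : ℤ) * q - 1 = s * (q - t) + (s * t - 1) by ring]
  exact dvd_add (h.dvd_qt.mul_left _) h.dvd_st

theorem lt_q : p < q := (Nat.le_mul_of_pos_left p h.t_pos).trans_lt h.mul_lt

theorem mul_add_lt {j : ℕ} (hj : j < p) : (t * j + t : ℤ) < q := by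
  have := (Nat.mul_le_mul_left t (Nat.succ_le_of_lt hj)).trans_lt h.mul_lt
  rw [Nat.mul_succ] at this
  exact_mod_cast this

theorem le_ediv_iff (e w : ℤ) : e ≤ w / q ↔ e * q ≤ w :=
  Int.le_ediv_iff_mul_le (by have := h.lt_q; omega)

theorem sub_le_ediv_iff (w : ℤ) : p - t ≤ w / q ↔ p * q - t * q ≤ w := by
  rw [h.le_ediv_iff, sub_mul]

theorem q_le_mul : (q : ℤ) ≤ t * q := le_mul_of_one_le_left (by omega) (by have := h.t_pos; omega)

theorem q_le_mul_sub_mul : (q : ℤ) ≤ p * q - t * q := by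
  rw [← sub_mul]
  exact le_mul_of_one_le_left (by omega) (by have := h.t_lt; omega)

theorem sub_mul_ediv (w : ℤ) {j : ℕ} (hj : j < p) :
    (w - t * j) / q = w / q - if breakIdx q t w ≤ j then 1 else 0 := by
  have hq : (0 : ℤ) < q := by have := h.lt_q; omega
  have ht : (0 : ℤ) < t := by exact_mod_cast h.t_pos
  have break_le : breakIdx q t w ≤ j ↔ w % q < t * j := by
    have := Int.ediv_nonneg (Int.emod_nonneg w hq.ne') ht.le
    rw [breakIdx, mul_comm, ← Int.ediv_lt_iff_lt_mul ht]
    omega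
  have := Int.mul_ediv_add_emod w q
  have := Int.emod_nonneg w hq.ne'
  have := Int.emod_lt_of_pos w hq
  have := h.mul_add_lt hj
  have : (0 : ℤ) ≤ t * j := by positivity
  rw [Int.ediv_eq_iff_of_pos hq]
  simp only [break_le]
  split_ifs <;> constructor <;> linarith

theorem binCoeff_sub_mul (w : ℤ) {j : ℕ} (hj : j < p) :
    binCoeff p q s (w - t * j) = arcInd p s (s * w - j) -
      arcInd p s (s * w - 1 - w / q - j + if breakIdx q t w ≤ j then 1 else 0) := by
  obtain ⟨c, hc⟩ := h.dvd_st
  rw [binCoeff, h.sub_mul_ediv w hj]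
  congr 1 <;> exact arcInd_congr ⟨-c * j, by linear_combination -(j : ℤ) * hc⟩

theorem winSum_eq_arcSum (w : ℤ) {x y : ℕ} (hy : y ≤ p) :
    winSum p q s t w x y = arcSum p s (s * w) (w / q) (breakIdx q t w) x y :=
  Finset.sum_congr rfl fun _ hj =>
    h.binCoeff_sub_mul w ((Finset.mem_Ico.1 hj).2.trans_le hy)

theorem winSum_add_mul (w : ℤ) (x y : ℕ) :
    winSum p q s t (w + p * q) x y = winSum p q s t w x y := by
  have hq : 0 < q := by have := h.lt_q; omega
  simp only [winSum, add_sub_right_comm w (p * q : ℤ), binCoeff_periodic hq _]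

theorem winSum_sub_mul (w : ℤ) : winSum p q s t (w - t * q) 0 p = winSum p q s t w 0 p := by
  obtain ⟨c, hc⟩ := h.dvd_sq
  have hq : (q : ℤ) ≠ 0 := by have := h.lt_q; omega
  have total (w : ℤ) : winSum p q s t w 0 p = s - ∑ j ∈ Finset.range p,
      arcInd p s (s * (w - t * j) - 1 - (w - t * j) / q) := by
    obtain ⟨m, hm⟩ := h.dvd_st
    simp only [winSum, binCoeff]
    rw [← Finset.range_eq_Ico, Finset.sum_sub_distrib, sub_left_inj]
    refine Eq.trans (Finset.sum_congr rfl fun j _ => ?_) (sum_range_arcInd h.s_lt.le (s * w))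
    exact arcInd_congr ⟨-m * j, by linear_combination -(j : ℤ) * hm⟩
  rw [total, total]
  congr 1
  refine Finset.sum_congr rfl fun j _ => arcInd_congr ⟨-c * t, ?_⟩
  rw [show w - t * q - t * j = w - t * j + (-t) * q by ring, Int.add_mul_ediv_right _ _ hq]
  linear_combination -(t : ℤ) * hc

theorem cutCoeff_eq_ite (N : ℤ) {z : ℤ} (h0 : -q ≤ z) (h1 : z < p * q) :
    cutCoeff p q s N z = if z ≤ N then binCoeff p q s z else 0 := by
  by_cases hz : 0 ≤ z
  · rw [cutCoeff, Int.emod_eq_of_lt hz h1]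
  · have hq : 0 < q := by have := h.lt_q; omega
    rw [← cutCoeff_periodic hq, cutCoeff, binCoeff_periodic hq, binCoeff_of_neg h0 (by omega),
      ite_self, ite_self]

theorem cutSum_eq_winSum {N w : ℤ} (h0 : 0 ≤ w) (h1 : w < p * q) {κ : ℕ}
    (hκ : ∀ j < p, w - t * j ≤ N ↔ κ ≤ j) : cutSum p q s t N w = winSum p q s t w κ p := by
  have term : ∀ j ∈ Finset.range p, cutCoeff p q s N (w - t * j) =
      if κ ≤ j then binCoeff p q s (w - t * j) else 0 := by
    intro j hj
    rw [Finset.mem_range] at hj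
    have := h.mul_add_lt hj
    have : (0 : ℤ) ≤ t * j := by positivity
    rw [h.cutCoeff_eq_ite N (by omega) (by omega)]
    simp only [hκ j hj]
  rw [cutSum, winSum, Finset.sum_congr rfl term, ← Finset.sum_filter]
  congr 1
  ext j
  simp only [Finset.mem_filter, Finset.mem_range, Finset.mem_Ico]
  omega

theorem cutSum_eq_zero {N w : ℤ} (h0 : 0 ≤ w) (h1 : w < p * q) (hN : N + q ≤ w) :
    cutSum p q s t N w = 0 := by
  rw [h.cutSum_eq_winSum h0 h1 (κ := p), winSum, Finset.Ico_self, Finset.sum_empty]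
  intro j hj
  have := h.mul_add_lt hj
  omega

theorem cutSum_eq_total {N w : ℤ} (h0 : 0 ≤ w) (h1 : w < p * q) (hN : w ≤ N) :
    cutSum p q s t N w = winSum p q s t w 0 p := by
  refine h.cutSum_eq_winSum h0 h1 fun j _ => ?_
  have : (0 : ℤ) ≤ t * j := by positivity
  omega

theorem exists_winSum_eq_cutSum_sub_cutSum (N : ℤ) {v u : ℤ} (hv : 0 ≤ v) (hvu : v + q ≤ u)
    (hu : u < p * q) (total : winSum p q s t v 0 p = winSum p q s t u 0 p) :
    ∃ (z : ℤ) (x y : ℕ), (z = u ∨ z = v) ∧ y ≤ p ∧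
      cutSum p q s t N v - cutSum p q s t N u = winSum p q s t z x y := by
  obtain ⟨κ, hκ, hu_iff⟩ := exists_threshold h.t_pos N u p
  rcases hκ.lt_or_eq with hlt | rfl
  · have := (hu_iff (p - 1) (by omega)).2 (by omega)
    have := h.mul_add_lt (by omega : p - 1 < p)
    refine ⟨u, 0, κ, Or.inl rfl, hκ, ?_⟩
    rw [h.cutSum_eq_winSum (by omega) hu hu_iff, h.cutSum_eq_total hv (by omega) (by omega), total,
      sub_eq_iff_eq_add]
    exact (Finset.sum_Ico_consecutive _ κ.zero_le hκ).symm
  · obtain ⟨κ', -, hv_iff⟩ := exists_threshold h.t_pos N v κ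
    refine ⟨v, κ', κ, Or.inr rfl, le_rfl, ?_⟩
    rw [h.cutSum_eq_winSum (by omega) hu hu_iff, h.cutSum_eq_winSum hv (by omega) hv_iff]
    simp only [winSum, Finset.Ico_self, Finset.sum_empty, sub_zero]

theorem exists_winSum_eq_cutDiff (N w : ℤ) : ∃ (z : ℤ) (x y : ℕ), 0 ≤ z ∧ z < p * q ∧ y ≤ p ∧
    ((cutDiff p q s t N w = winSum p q s t z x y ∧ (z / q < t ∨ p - t ≤ z / q)) ∨
      (cutDiff p q s t N w = -winSum p q s t z x y ∧ (z / q < p - t ∨ t ≤ z / q))) := by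
  have hq : 0 < q := by have := h.lt_q; omega
  have htq := h.q_le_mul
  have htq' := h.q_le_mul_sub_mul
  obtain ⟨v, hv0, hv, hwv⟩ := exists_dvd_sub_of_pos (by omega : (0 : ℤ) < p * q) w
  rw [eq_of_periodic_of_dvd_sub (cutDiff_periodic hq N) hwv, cutDiff]
  rcases le_or_gt (t * q : ℤ) v with hle | hgt
  · obtain ⟨z, x, y, hz, hy, hzw⟩ := h.exists_winSum_eq_cutSum_sub_cutSum N
      (v := v - t * q) (u := v) (by omega) (by omega) hv (h.winSum_sub_mul v)
    refine ⟨z, x, y, by omega, by omega, hy, Or.inr ⟨by rw [← hzw, neg_sub], ?_⟩⟩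
    rw [← not_le, h.sub_le_ediv_iff, h.le_ediv_iff]
    omega
  · have shift := (cutSum_periodic (p := p) (s := s) (t := t) hq N) (v - t * q)
    obtain ⟨z, x, y, hz, hy, hzw⟩ := h.exists_winSum_eq_cutSum_sub_cutSum N (v := v)
      (u := v - t * q + p * q) hv0 (by omega) (by omega)
      (by rw [h.winSum_add_mul, h.winSum_sub_mul])
    refine ⟨z, x, y, by omega, by omega, hy, Or.inl ⟨by rw [← hzw, shift], ?_⟩⟩
    rw [← not_le, h.le_ediv_iff, h.sub_le_ediv_iff]
    omega

theorem cutSum_sub_mul_self {w : ℤ} (h0 : 0 ≤ w) (h1 : w < p * q) (κ : ℕ) :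
    cutSum p q s t (w - t * κ) w = winSum p q s t w κ p := by
  have ht : (0 : ℤ) < t := by exact_mod_cast h.t_pos
  refine h.cutSum_eq_winSum h0 h1 fun j _ => ?_
  rw [sub_le_sub_iff_left, mul_le_mul_iff_right₀ ht, Nat.cast_le]

theorem cutDiff_eq_winSum {w : ℤ} (h0 : 0 ≤ w) (h1 : w < p * q) {κ : ℕ} (hκ : κ < p)
    (hw : w / q < t ∨ winSum p q s t w 0 p = 0) :
    cutDiff p q s t (w - t * κ) w = winSum p q s t w κ p := by
  have hq : 0 < q := by have := h.lt_q; omega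
  have htκ := h.mul_add_lt hκ
  have htκ0 : (0 : ℤ) ≤ t * κ := by positivity
  have htq := h.q_le_mul
  have htq' := h.q_le_mul_sub_mul
  rw [cutDiff, h.cutSum_sub_mul_self h0 h1, sub_eq_self]
  by_cases hlt : t ≤ w / q
  · rw [h.le_ediv_iff] at hlt
    rw [h.cutSum_eq_total (by omega) (by omega) (by omega), h.winSum_sub_mul]
    exact hw.resolve_left (by rw [← not_le, h.le_ediv_iff]; omega)
  · rw [h.le_ediv_iff] at hlt
    rw [← cutSum_periodic hq, h.cutSum_eq_zero (by omega) (by omega) (by omega)]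

theorem cutDiff_eq_neg_winSum {w : ℤ} (h0 : 0 ≤ w) (h1 : w < p * q) {κ : ℕ} (hκ : κ < p)
    (hw : w / q < p - t ∨ winSum p q s t w 0 p = 0) :
    cutDiff p q s t (w - t * κ) (w + t * q) = -winSum p q s t w κ p := by
  have hq : 0 < q := by have := h.lt_q; omega
  have htκ := h.mul_add_lt hκ
  have htκ0 : (0 : ℤ) ≤ t * κ := by positivity
  have htq := h.q_le_mul
  have htq' := h.q_le_mul_sub_mul
  rw [cutDiff, add_sub_cancel_right, h.cutSum_sub_mul_self h0 h1, sub_eq_neg_self]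
  by_cases hlt : p - t ≤ w / q
  · have total : winSum p q s t (w + t * q - p * q) 0 p = winSum p q s t w 0 p := by
      rw [← h.winSum_add_mul, sub_add_cancel, ← h.winSum_sub_mul, add_sub_cancel_right]
    rw [h.sub_le_ediv_iff] at hlt
    rw [← (cutSum_periodic hq _).sub_eq,
      h.cutSum_eq_total (by omega) (by omega) (by omega), total]
    exact hw.resolve_left (by rw [← not_le, h.sub_le_ediv_iff]; omega)
  · rw [h.sub_le_ediv_iff] at hlt
    rw [h.cutSum_eq_zero (by omega) (by omega) (by omega)]

end Admissible

/-- `k` is the shorter of the lengths `s` and `p - s` of an arc of `ℤ / p` and its complement. The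
sign `ε` and the shift `η` are those by which passing to the complement changes a window of
binary coefficients, see `Admissible.mul_winSum_eq_arcSum`. -/
structure ShortArc (p s k : ℕ) (ε η : ℤ) : Prop where
  cases : (k = s ∧ ε = 1 ∧ η = 0) ∨ (k + s = p ∧ ε = -1 ∧ η = 1)
  two_mul_lt : 2 * k < p

section ShortArc

variable {p q s t k : ℕ} {ε η : ℤ} (h : Admissible p q s t) (d : ShortArc p s k ε η)

include d in
theorem ShortArc.mul_self_eq_one : ε * ε = 1 := by
  rcases d.cases with ⟨-, rfl, -⟩ | ⟨-, rfl, -⟩ <;> norm_num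

include h d

namespace Admissible

theorem shortArc_pos : 0 < k := by
  have := h.s_pos
  have := h.s_lt
  rcases d.cases with hk | hk <;> omega

theorem mul_winSum_eq_arcSum (w : ℤ) {x y : ℕ} (hy : y ≤ p) :
    ε * winSum p q s t w x y = arcSum p k (s * (w - η)) (w / q) (breakIdx q t w) x y := by
  have hp : 0 < p := h.s_pos.trans h.s_lt
  rw [h.winSum_eq_arcSum w hy]
  rcases d.cases with ⟨rfl, rfl, rfl⟩ | ⟨hk, rfl, rfl⟩
  · rw [one_mul, sub_zero]
  · rw [arcSum, arcSum, Finset.mul_sum]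
    refine Finset.sum_congr rfl fun j _ => ?_
    rw [arcInd_eq_one_sub_arcInd (by omega : s + k = p) hp,
      arcInd_eq_one_sub_arcInd (by omega : s + k = p) hp, neg_one_mul, sub_sub_sub_cancel_left,
      neg_sub]
    congr 2 <;> ring

theorem neg_sub_one_le_mul_winSum (w : ℤ) {x y : ℕ} (hy : y ≤ p) :
    -k - 1 ≤ ε * winSum p q s t w x y := by
  have := d.two_mul_lt
  rw [h.mul_winSum_eq_arcSum d w hy]
  exact neg_sub_one_le_arcSum (by omega) _ _ _ (by omega)

theorem mul_winSum_le (w : ℤ) {x y : ℕ} (hy : y ≤ p) : ε * winSum p q s t w x y ≤ k := by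
  have := d.two_mul_lt
  rw [h.mul_winSum_eq_arcSum d w hy]
  exact arcSum_le (by omega) _ _ _ (by omega)

omit d in
theorem s_eq_one (ht : t = 1) : s = 1 := by
  have := h.s_pos
  have := h.s_lt
  have dvd := h.dvd_st
  rw [ht, Nat.cast_one, mul_one, dvd_iff_eq_zero_of_lt (by omega) (by omega)] at dvd
  omega

theorem of_mul_winSum_le {w : ℤ} (h0 : 0 ≤ w) (h1 : w < p * q) {x y : ℕ} (hy : y ≤ p)
    (hw : ε * winSum p q s t w x y ≤ -k - 1) : k ≤ w / q ∧ w / q + k < p ∧ t ≠ 1 := by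
  have hq : (0 : ℤ) < q := by have := h.lt_q; omega
  have hk := h.shortArc_pos d
  have hkp := d.two_mul_lt
  rw [h.mul_winSum_eq_arcSum d w hy] at hw
  obtain ⟨le, lt, repeated⟩ := of_arcSum_le hk (by omega) hy
    (Int.ediv_nonneg h0 hq.le) (Int.ediv_lt_of_lt_mul hq h1) hw
  refine ⟨le, lt, fun ht => ?_⟩
  obtain ⟨rfl, -, rfl⟩ : k = s ∧ ε = 1 ∧ η = 0 :=
    d.cases.resolve_right (by have := h.s_eq_one ht; omega)
  obtain ⟨c, hc⟩ := h.dvd_qt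
  have breakIdx_eq : (breakIdx q t w : ℤ) = w % q + 1 := by
    have := Int.emod_nonneg w hq.ne'
    rw [breakIdx, ht, Nat.cast_one, Int.ediv_one]
    omega
  rw [breakIdx_eq, h.s_eq_one ht, arcInd_of_dvd_sub (d := p - 1) _ (by omega) (by omega),
    if_neg (by omega)] at repeated
  · exact zero_ne_one repeated
  · rw [ht] at hc
    exact ⟨c * (w / q) - 1, by
      push_cast at hc ⊢; linear_combination (w / q) * hc - Int.mul_ediv_add_emod w q⟩

theorem le_shortArc_mul (ht : t ≠ 1) : p - η ≤ k * t := by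
  have hs := h.s_pos
  have ht0 := h.t_pos
  obtain ⟨c, hc⟩ := h.dvd_st
  rcases d.cases with ⟨rfl, -, rfl⟩ | ⟨hk, -, rfl⟩
  · have : 1 * 2 ≤ k * t := Nat.mul_le_mul hs (by omega)
    have : (1 * 2 : ℤ) ≤ k * t := by exact_mod_cast this
    have := Int.le_of_dvd (by omega) h.dvd_st
    omega
  · have : 0 < k * t := Nat.mul_pos (h.shortArc_pos d) ht0
    have : (0 : ℤ) < k * t := by exact_mod_cast this
    have : (p : ℤ) ∣ k * t + 1 := ⟨t - c, by
      rw [← hk] at hc ⊢; push_cast at hc ⊢; linear_combination -hc⟩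
    have := Int.le_of_dvd (by omega) this
    omega

theorem exists_mul_winSum_eq_arcSum {e β : ℤ} (he : 0 ≤ e) (hep : e < p) (hβ : 0 ≤ β)
    (hβq : β < q) : ∃ w : ℤ, 0 ≤ w ∧ w < p * q ∧ w / q = e ∧ ∀ x y, y ≤ p →
      ε * winSum p q s t w x y = arcSum p k (s * (β + q * e - η)) e ((β / t).toNat + 1) x y := by
  have hq : (0 : ℤ) < q := hβ.trans_lt hβq
  obtain ⟨ediv, emod⟩ := (Int.ediv_emod_unique hq).2 ⟨rfl, hβ, hβq⟩
  have : (e + 1) * q ≤ p * q := mul_le_mul_of_nonneg_right (by omega) hq.le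
  refine ⟨β + q * e, by positivity, by linarith, ediv, fun x y hy => ?_⟩
  rw [h.mul_winSum_eq_arcSum d _ hy, breakIdx, ediv, emod]

theorem exists_mul_winSum_eq_neg_sub_one (ht : t ≠ 1) : ∃ w : ℤ, 0 ≤ w ∧ w < p * q ∧ w / q = k ∧
    ε * winSum p q s t w k p = -k - 1 := by
  have hkp := d.two_mul_lt
  have hk := h.shortArc_pos d
  have hkt := h.le_shortArc_mul d ht
  have ht0 : (0 : ℤ) < t := by exact_mod_cast h.t_pos
  have hη : 0 ≤ η ∧ η ≤ 1 := by rcases d.cases with hd | hd <;> omega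
  have htp : (2 * (p - 1) : ℤ) ≤ t * (p - 1) :=
    mul_le_mul_of_nonneg_right (by omega) (by omega)
  have htq := h.mul_add_lt (by omega : p - 1 < p)
  rw [Nat.cast_pred (by omega)] at htq
  obtain ⟨w, h0, h1, hw, hsum⟩ := h.exists_mul_winSum_eq_arcSum d (e := k)
    (β := t * (p - 1) - p + η) (by omega) (by omega) (by omega) (by omega)
  have lower : (p - 1 - k : ℤ) ≤ (t * (p - 1) - p + η) / t := by
    rw [Int.le_ediv_iff_mul_le ht0]
    linarith
  have upper : (t * (p - 1) - p + η) / t < (p - 1 : ℤ) := by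
    rw [Int.ediv_lt_iff_lt_mul ht0]
    linarith
  refine ⟨w, h0, h1, hw, (hsum k p le_rfl).trans (arcSum_eq_neg_sub_one hkp ?_ ?_ ?_)⟩
  · obtain ⟨a, ha⟩ := h.dvd_st
    obtain ⟨b, hb⟩ := h.dvd_sq
    exact ⟨a * (p - 1) + b * k + 1 - s, by linear_combination (p - 1 : ℤ) * ha + (k : ℤ) * hb⟩
  · omega
  · omega

theorem shift_nonneg_and_lt : 0 ≤ η ∧ t * p + η < q := by
  have := h.s_lt
  have := h.t_lt
  have := h.t_pos
  have := d.two_mul_lt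
  have lt : (t * p : ℤ) < q := by exact_mod_cast h.mul_lt
  rcases d.cases with ⟨-, -, rfl⟩ | ⟨hk, -, rfl⟩
  · exact ⟨le_rfl, by rwa [add_zero]⟩
  · refine ⟨zero_le_one, lt_of_le_of_ne (by omega) fun hq => ?_⟩
    obtain ⟨c, hc⟩ := h.dvd_qt
    have dvd : (p : ℤ) ∣ 1 - t := ⟨c - t, by linear_combination hc + hq⟩
    rw [dvd_iff_eq_zero_of_lt (by omega) (by omega)] at dvd
    have := h.s_eq_one (by omega)
    omega

theorem exists_mul_winSum_eq_neg : ∃ w : ℤ, 0 ≤ w ∧ w < p * q ∧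
    ε * winSum p q s t w (p - k) p = -k ∧ winSum p q s t w 0 p = 0 := by
  have hkp := d.two_mul_lt
  have hk := h.shortArc_pos d
  have ht0 : (0 : ℤ) < t := by exact_mod_cast h.t_pos
  obtain ⟨hη, hηq⟩ := h.shift_nonneg_and_lt d
  obtain ⟨w, h0, h1, -, hsum⟩ := h.exists_mul_winSum_eq_arcSum d (e := k - 1)
    (β := t * p + η) (by omega) (by omega) (by positivity) hηq
  have break_ge : (p : ℤ) ≤ (t * p + η) / t := by
    rw [Int.le_ediv_iff_mul_le ht0]
    linarith
  refine ⟨w, h0, h1, (hsum _ p le_rfl).trans (arcSum_eq_neg hkp.le ?_ (by omega)), ?_⟩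
  · obtain ⟨b, hb⟩ := h.dvd_sq
    exact ⟨s * t + b * (k - 1), by linear_combination (k - 1 : ℤ) * hb⟩
  · have total := (hsum 0 p le_rfl).trans (arcSum_range_eq_zero (by omega) _ _ (by omega))
    exact (mul_eq_zero.1 total).resolve_left fun hε => by simpa [hε] using d.mul_self_eq_one

theorem ite_le_mul_cutDiff (N w : ℤ) :
    (if k < t ∧ t ≠ 1 then -k - 1 else -k : ℤ) ≤ ε * cutDiff p q s t N w := by
  obtain ⟨z, x, y, h0, h1, hy, hz⟩ := h.exists_winSum_eq_cutDiff N w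
  have lower := h.neg_sub_one_le_mul_winSum d z (x := x) hy
  have upper := h.mul_winSum_le d z (x := x) hy
  have extremal := h.of_mul_winSum_le d h0 h1 (x := x) hy
  rcases hz with ⟨hz, hblock⟩ | ⟨hz, -⟩
  · rw [hz]
    split_ifs <;> omega
  · rw [hz, mul_neg]
    split_ifs <;> omega

theorem mul_cutDiff_le_ite (N w : ℤ) :
    ε * cutDiff p q s t N w ≤ (if k < p - t ∧ t ≠ 1 then k + 1 else k : ℤ) := by
  obtain ⟨z, x, y, h0, h1, hy, hz⟩ := h.exists_winSum_eq_cutDiff N w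
  have lower := h.neg_sub_one_le_mul_winSum d z (x := x) hy
  have upper := h.mul_winSum_le d z (x := x) hy
  have extremal := h.of_mul_winSum_le d h0 h1 (x := x) hy
  rcases hz with ⟨hz, -⟩ | ⟨hz, hblock⟩
  · rw [hz]
    split_ifs <;> omega
  · rw [hz, mul_neg]
    split_ifs <;> omega

theorem exists_mul_cutDiff_eq_lower : ∃ N w : ℤ,
    ε * cutDiff p q s t N w = (if k < t ∧ t ≠ 1 then -k - 1 else -k : ℤ) := by
  have hkp := d.two_mul_lt
  have hk := h.shortArc_pos d
  split_ifs with hkt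
  · obtain ⟨w, h0, h1, hw, hsum⟩ := h.exists_mul_winSum_eq_neg_sub_one d hkt.2
    exact ⟨w - t * k, w, by rw [h.cutDiff_eq_winSum h0 h1 (by omega) (by omega), hsum]⟩
  · obtain ⟨w, h0, h1, hsum, total⟩ := h.exists_mul_winSum_eq_neg d
    refine ⟨w - t * (p - k : ℕ), w, ?_⟩
    rw [h.cutDiff_eq_winSum h0 h1 (by omega) (.inr total), hsum]

theorem exists_mul_cutDiff_eq_upper : ∃ N w : ℤ,
    ε * cutDiff p q s t N w = (if k < p - t ∧ t ≠ 1 then k + 1 else k : ℤ) := by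
  have hkp := d.two_mul_lt
  have hk := h.shortArc_pos d
  split_ifs with hkt
  · obtain ⟨w, h0, h1, hw, hsum⟩ := h.exists_mul_winSum_eq_neg_sub_one d hkt.2
    refine ⟨w - t * k, w + t * q, ?_⟩
    rw [h.cutDiff_eq_neg_winSum h0 h1 (by omega) (by omega), mul_neg, hsum]
    ring
  · obtain ⟨w, h0, h1, hsum, total⟩ := h.exists_mul_winSum_eq_neg d
    refine ⟨w - t * (p - k : ℕ), w + t * q, ?_⟩
    rw [h.cutDiff_eq_neg_winSum h0 h1 (by omega) (.inr total), mul_neg, hsum, neg_neg]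

end Admissible

end ShortArc

namespace Admissible

variable {p q s t r : ℕ} (h : Admissible p q s t)
include h

theorem add_le_of_dvd {τ : ℤ} (hτ : τ = 1 ∨ τ = -1) (hr : r ≠ 1) (hrt : (p * q : ℤ) ∣ r * t - τ) :
    p + q ≤ r := by
  by_contra! hlt
  have ht0 := h.t_pos
  have htp := h.t_lt
  have hpq := h.lt_q
  have pq_ge : (2 * 2 : ℤ) ≤ p * q := by exact_mod_cast Nat.mul_le_mul (by omega) (by omega)
  have rt_nonneg : (0 : ℤ) ≤ r * t := by positivity
  have rt_lt : (r * t + 1 : ℤ) < p * q := by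
    have hr_le : (r * t : ℤ) ≤ (p + (q - 1)) * t := mul_le_mul_of_nonneg_right (by omega) (by omega)
    have ht_le : ((q - 1) * t : ℤ) ≤ (q - 1) * (p - 1) :=
      mul_le_mul_of_nonneg_left (by omega) (by omega)
    have hlt_q : (t * p : ℤ) < q := by exact_mod_cast h.mul_lt
    linarith
  rw [dvd_iff_eq_zero_of_lt (by omega) (by omega)] at hrt
  have rt_eq : r * t = 1 := by
    zify
    omega
  exact hr (Nat.eq_one_of_mul_eq_one_right rt_eq)

omit h in
theorem coprime_of_dvd {m : ℕ} {τ : ℤ} (hτ : τ = 1 ∨ τ = -1) (hrt : (m : ℤ) ∣ r * t - τ) :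
    m.Coprime r := by
  have mul_self : τ * τ = 1 := by rcases hτ with rfl | rfl <;> norm_num
  obtain ⟨c, hc⟩ := hrt
  exact coprime_of_dvd_mul_sub_one (a := τ * t)
    ⟨τ * c, by linear_combination τ * hc + mul_self⟩

theorem mem_coeffSet_iff_cutDiff (hr : r ≠ 1) (hrt : (p * q : ℤ) ∣ r * t - 1) {a : ℤ} :
    a ∈ coeffSet p q r ↔ ∃ N w : ℤ, cutDiff p q s t N w = a :=
  InclusionExclusion.mem_coeffSet_iff_cutDiff h.lt_q (h.add_le_of_dvd (.inl rfl) hr hrt) h.s_pos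
    h.s_lt h.dvd_sq (coprime_of_dvd (.inl rfl) (dvd_of_mul_left_dvd hrt))
    (coprime_of_dvd (.inl rfl) (dvd_of_mul_right_dvd hrt)).symm hrt

theorem coeffSet_eq_image_neg {r' : ℕ} (hr : r ≠ 1) (hrt : (p * q : ℤ) ∣ r * t - 1)
    (hrt' : (p * q : ℤ) ∣ r' * t - -1) :
    coeffSet p q r' = (coeffSet p q r).image (fun a => -a) := by
  have hr' : r' ≠ 1 := by
    rintro rfl
    have := h.t_lt
    have := h.lt_q
    have hqpq : (q : ℤ) ≤ p * q := le_mul_of_one_le_left (by omega) (by omega)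
    have := Int.le_of_dvd (by omega) hrt'
    omega
  refine InclusionExclusion.coeffSet_eq_image_neg h.lt_q h.s_pos h.s_lt h.dvd_sq
    (h.add_le_of_dvd (.inl rfl) hr hrt) (coprime_of_dvd (.inl rfl) (dvd_of_mul_left_dvd hrt))
    (coprime_of_dvd (.inl rfl) (dvd_of_mul_right_dvd hrt)).symm
    (h.add_le_of_dvd (.inr rfl) hr' hrt') (coprime_of_dvd (.inr rfl) (dvd_of_mul_left_dvd hrt'))
    (coprime_of_dvd (.inr rfl) (dvd_of_mul_right_dvd hrt')).symm ?_
  obtain ⟨a, ha⟩ := hrt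
  obtain ⟨b, hb⟩ := hrt'
  have : (p * q : ℤ) ∣ r + r' :=
    ⟨r * b - r' * a, by linear_combination (r : ℤ) * hb - (r' : ℤ) * ha⟩
  exact_mod_cast this

theorem two_mul_ne (hp : 3 ≤ p) : 2 * s ≠ p := by
  intro hs
  obtain ⟨c, hc⟩ := h.dvd_st
  have dvd : (s : ℤ) ∣ 1 := ⟨t - 2 * c, by rw [← hs] at hc; push_cast at hc; linear_combination -hc⟩
  have := Int.le_of_dvd one_pos dvd
  omega

end Admissible

theorem Aminus_eq_of_isLeast {p q r : ℕ} {a : ℤ} (h : IsLeast (coeffSet p q r : Set ℤ) a) :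
    Aminus p q r = a :=
  (Finset.isLeast_min' _ _).unique h

theorem Aplus_eq_of_isGreatest {p q r : ℕ} {a : ℤ}
    (h : IsGreatest (coeffSet p q r : Set ℤ) a) : Aplus p q r = a :=
  (Finset.isGreatest_max' _ _).unique h

theorem height_eq_max (p q r : ℕ) : height p q r = max (-Aminus p q r) (Aplus p q r) := by
  apply le_antisymm
  · refine Finset.sup'_le _ _ fun a ha => abs_le'.2 ⟨?_, ?_⟩
    · exact (Finset.le_max' _ a ha).trans (le_max_right _ _)
    · exact (neg_le_neg (Finset.min'_le _ a ha)).trans (le_max_left _ _)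
  · exact max_le
      ((neg_le_abs _).trans (Finset.le_sup' (fun a : ℤ => |a|) (Finset.min'_mem _ _)))
      ((le_abs_self _).trans (Finset.le_sup' (fun a : ℤ => |a|) (Finset.max'_mem _ _)))

namespace Admissible

variable {p q s t r : ℕ} (h : Admissible p q s t) (hr : r ≠ 1) (hrt : (p * q : ℤ) ∣ r * t - 1)
include h hr hrt

theorem isLeast_image_coeffSet {k : ℕ} {ε η : ℤ} (d : ShortArc p s k ε η) :
    IsLeast ((fun a => ε * a) '' (coeffSet p q r : Set ℤ))
      (if k < t ∧ t ≠ 1 then -k - 1 else -k) := by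
  constructor
  · obtain ⟨N, w, hNw⟩ := h.exists_mul_cutDiff_eq_lower d
    exact ⟨_, (h.mem_coeffSet_iff_cutDiff hr hrt).2 ⟨N, w, rfl⟩, hNw⟩
  · rintro _ ⟨a, ha, rfl⟩
    obtain ⟨N, w, rfl⟩ := (h.mem_coeffSet_iff_cutDiff hr hrt).1 ha
    exact h.ite_le_mul_cutDiff d N w

theorem isGreatest_image_coeffSet {k : ℕ} {ε η : ℤ} (d : ShortArc p s k ε η) :
    IsGreatest ((fun a => ε * a) '' (coeffSet p q r : Set ℤ))
      (if k < p - t ∧ t ≠ 1 then k + 1 else k) := by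
  constructor
  · obtain ⟨N, w, hNw⟩ := h.exists_mul_cutDiff_eq_upper d
    exact ⟨_, (h.mem_coeffSet_iff_cutDiff hr hrt).2 ⟨N, w, rfl⟩, hNw⟩
  · rintro _ ⟨a, ha, rfl⟩
    obtain ⟨N, w, rfl⟩ := (h.mem_coeffSet_iff_cutDiff hr hrt).1 ha
    exact h.mul_cutDiff_le_ite d N w

theorem Aminus_eq_of_two_mul_lt (hs : 2 * s < p) :
    Aminus p q r = if s < t ∧ t ≠ 1 then -(s : ℤ) - 1 else -s := by
  have least := h.isLeast_image_coeffSet hr hrt ⟨.inl ⟨rfl, rfl, rfl⟩, hs⟩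
  simp only [one_mul, Set.image_id'] at least
  exact Aminus_eq_of_isLeast least

theorem Aplus_eq_of_two_mul_lt (hs : 2 * s < p) :
    Aplus p q r = if s + t < p ∧ t ≠ 1 then (s : ℤ) + 1 else s := by
  have greatest := h.isGreatest_image_coeffSet hr hrt ⟨.inl ⟨rfl, rfl, rfl⟩, hs⟩
  simp only [one_mul, Set.image_id', Nat.lt_sub_iff_add_lt] at greatest
  exact Aplus_eq_of_isGreatest greatest

theorem Aminus_eq_of_lt_two_mul (hs : p < 2 * s) :
    Aminus p q r = if t < s ∧ t ≠ 1 then (s : ℤ) - p - 1 else s - p := by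
  obtain ⟨k, hk⟩ := Nat.exists_eq_add_of_lt h.s_lt
  have greatest := h.isGreatest_image_coeffSet hr hrt (k := k + 1)
    ⟨.inr ⟨by omega, rfl, rfl⟩, by omega⟩
  have least := Antitone.map_isGreatest (fun _ _ => neg_le_neg) greatest
  simp only [Set.image_image, neg_one_mul, neg_neg, Set.image_id'] at least
  rw [Aminus_eq_of_isLeast least]
  split_ifs <;> omega

theorem Aplus_eq_of_lt_two_mul (hs : p < 2 * s) :
    Aplus p q r = if p < s + t ∧ t ≠ 1 then (p : ℤ) - s + 1 else p - s := by
  obtain ⟨k, hk⟩ := Nat.exists_eq_add_of_lt h.s_lt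
  have least := h.isLeast_image_coeffSet hr hrt (k := k + 1)
    ⟨.inr ⟨by omega, rfl, rfl⟩, by omega⟩
  have greatest := Antitone.map_isLeast (fun _ _ => neg_le_neg) least
  simp only [Set.image_image, neg_one_mul, neg_neg, Set.image_id'] at greatest
  rw [Aplus_eq_of_isGreatest greatest]
  split_ifs <;> omega

end Admissible

end InclusionExclusion

theorem theorem3_general (p t s q r r' : ℕ) (hp : 3 ≤ p)
    (ht1 : 1 ≤ t) (htp : t ≤ p - 1)
    (hs1 : 1 ≤ s) (hsp : s ≤ p - 1) (hst : s * t ≡ 1 [MOD p])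
    (hq : t * p < q) (hr : r ≠ 1)
    (hqt : q ≡ t [MOD p])
    (hrt : (r : ℤ) * (t : ℤ) ≡ 1 [ZMOD (p : ℤ) * (q : ℤ)])
    (hrt' : (r' : ℤ) * (t : ℤ) ≡ -1 [ZMOD (p : ℤ) * (q : ℤ)]) :
    InclusionExclusion.coeffSet p q r'
        = (InclusionExclusion.coeffSet p q r).image (fun a => -a) ∧
    (t = 1 → s = 1 →
      InclusionExclusion.Aminus p q r = -1 ∧
      InclusionExclusion.Aplus p q r = 1 ∧
      InclusionExclusion.height p q r = 1) ∧
    (1 < t → min s (p - s) < min t (p - t) →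
      InclusionExclusion.Aminus p q r = -((min s (p - s) : ℕ) : ℤ) - 1 ∧
      InclusionExclusion.Aplus p q r = ((min s (p - s) : ℕ) : ℤ) + 1 ∧
      InclusionExclusion.height p q r = ((min s (p - s) : ℕ) : ℤ) + 1) ∧
    (1 < t → min t (p - t) ≤ min s (p - s) →
      ((min t (p - t), min s (p - s)) = (t, s) ∨
        (min t (p - t), min s (p - s)) = (p - t, p - s)) →
      InclusionExclusion.Aminus p q r = -((min s (p - s) : ℕ) : ℤ) ∧
      InclusionExclusion.Aplus p q r = ((min s (p - s) : ℕ) : ℤ) + 1 ∧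
      InclusionExclusion.height p q r = ((min s (p - s) : ℕ) : ℤ) + 1) ∧
    (1 < t → min t (p - t) ≤ min s (p - s) →
      ((min t (p - t), min s (p - s)) = (t, p - s) ∨
        (min t (p - t), min s (p - s)) = (p - t, s)) →
      InclusionExclusion.Aminus p q r = -((min s (p - s) : ℕ) : ℤ) - 1 ∧
      InclusionExclusion.Aplus p q r = ((min s (p - s) : ℕ) : ℤ) ∧
      InclusionExclusion.height p q r = ((min s (p - s) : ℕ) : ℤ) + 1) := by
  open InclusionExclusion in
  have hst' : (p : ℤ) ∣ s * t - 1 := by exact_mod_cast Nat.modEq_iff_dvd.1 hst.symm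
  have hrt₁ := Int.modEq_iff_dvd.1 hrt.symm
  have h : Admissible p q s t :=
    ⟨hs1, by omega, ht1, by omega, hst', Nat.modEq_iff_dvd.1 hqt.symm, hq⟩
  refine ⟨h.coeffSet_eq_image_neg hr hrt₁ (Int.modEq_iff_dvd.1 hrt'.symm), ?_⟩
  simp only [height_eq_max, Prod.mk.injEq]
  rcases (h.two_mul_ne hp).lt_or_gt with hs | hs
  · rw [h.Aminus_eq_of_two_mul_lt hr hrt₁ hs, h.Aplus_eq_of_two_mul_lt hr hrt₁ hs]
    split_ifs <;> omega
  · rw [h.Aminus_eq_of_lt_two_mul hr hrt₁ hs, h.Aplus_eq_of_lt_two_mul hr hrt₁ hs]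
    split_ifs <;> omega

theorem theorem3 (p t s q r r' : ℕ) (hp : 3 ≤ p)
    (ht1 : 1 ≤ t) (htp : t ≤ p - 1) (htcop : t.Coprime p)
    (hs1 : 1 ≤ s) (hsp : s ≤ p - 1) (hst : s * t ≡ 1 [MOD p])
    (hq : p ^ 2 < q) (hr : q < r) (hr' : q < r')
    (hqt : q ≡ t [MOD p])
    (hrt : (r : ℤ) * (t : ℤ) ≡ 1 [ZMOD (p : ℤ) * (q : ℤ)])
    (hrt' : (r' : ℤ) * (t : ℤ) ≡ -1 [ZMOD (p : ℤ) * (q : ℤ)]) :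
    -- the coefficient set of the second triple is the negative of that of the first
    InclusionExclusion.coeffSet p q r'
        = (InclusionExclusion.coeffSet p q r).image (fun a => -a) ∧
    -- first case
    (t = 1 → s = 1 →
      InclusionExclusion.Aminus p q r = -1 ∧
      InclusionExclusion.Aplus p q r = 1 ∧
      InclusionExclusion.height p q r = 1) ∧
    -- second case
    (1 < t → min s (p - s) < min t (p - t) →
      InclusionExclusion.Aminus p q r = -((min s (p - s) : ℕ) : ℤ) - 1 ∧
      InclusionExclusion.Aplus p q r = ((min s (p - s) : ℕ) : ℤ) + 1 ∧
      InclusionExclusion.height p q r = ((min s (p - s) : ℕ) : ℤ) + 1) ∧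
    -- third case
    (1 < t → min t (p - t) ≤ min s (p - s) →
      ((min t (p - t), min s (p - s)) = (t, s) ∨
        (min t (p - t), min s (p - s)) = (p - t, p - s)) →
      InclusionExclusion.Aminus p q r = -((min s (p - s) : ℕ) : ℤ) ∧
      InclusionExclusion.Aplus p q r = ((min s (p - s) : ℕ) : ℤ) + 1 ∧
      InclusionExclusion.height p q r = ((min s (p - s) : ℕ) : ℤ) + 1) ∧
    -- fourth case
    (1 < t → min t (p - t) ≤ min s (p - s) →
      ((min t (p - t), min s (p - s)) = (t, p - s) ∨
        (min t (p - t), min s (p - s)) = (p - t, s)) →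
      InclusionExclusion.Aminus p q r = -((min s (p - s) : ℕ) : ℤ) - 1 ∧
      InclusionExclusion.Aplus p q r = ((min s (p - s) : ℕ) : ℤ) ∧
      InclusionExclusion.height p q r = ((min s (p - s) : ℕ) : ℤ) + 1) :=
  theorem3_general p t s q r r' hp ht1 htp hs1 hsp hst
    ((Nat.mul_le_mul_right p (by omega)).trans_lt (sq p ▸ hq)) (by omega) hqt hrt hrt'
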